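/- Let $X$ be a separable metric space, let $\phi:\mathbb R\times X\to X$ be a continuous flow, write $\phi_t=\phi(t,\cdot)$ and $\mathcal F(x)=\{\phi_t(x):t\in\mathbb R\}$, and let $\mu$ be a Borel probability measure on $X$ that is invariant and ergodic for the time-one map $\phi_1$. The leaf topology on $\mathcal F(x)$ is the final topology for $t\mapsto\phi_t(x)$. A foliated chart is a homeomorphism $\psi$ from $S\times(0,1)$, for some topological space $S$, onto an open set $U\subset X$ such that each plaque $\psi(\{s\}\times(0,1))$ is an orbit segment $\phi(I\times\{x\})$ for some $x\in X$ and some open interval $I\subset\mathbb R$ on which $\tau\mapsto\phi(\tau,x)$ is injective. Then at least one of the following holds. 1. There are a Borel set $A\subset X$ with $\mu(A)=1$ and an integer $k\ge 1$ such that, for every $x\in X$, $\mathcal F(x)\cap A$ is discrete in the leaf topology of $\mathcal F(x)$ and, for every $x\in A$, $\mathcal F(x)\cap A$ is the disjoint union of the (two-sided) $\phi_1$-orbits of exactly $k$ points. 2. There is a family of Borel measures $\mu_{\mathcal F(x)}$ on $X$, one for each orbit, such that for every foliated chart with domain $U$ the restrictions of these measures to the plaques, normalized to probability measures, form a disintegration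 of $\mu|_U$ along the partition of $U$ into plaques, and such that for $\mu$-almost every $x\in X$: $\mu_{\mathcal F(x)}$ is nonzero, concentrated on $\mathcal F(x)$ and $\phi_1$-invariant, and $$\mu_{\mathcal F(x)}(\phi([0,t]\times\{x\}))=\tfrac t2$$ for every $t\ge 0$ for which $\tau\mapsto\phi(\tau,x)$ is injective on $[0,t]$. In particular, $\mu$ is invariant under $\phi_t$ for every $t\in\mathbb R$. Here a disintegration of a measure $\nu$ on $U$ along the plaques is a family $(\kappa_P)$ of measures on $U$, indexed by the plaques, such that for every Borel set $B\subset U$ the map $P\mapsto\kappa_P(B)$ is measurable for the quotient $\sigma$-algebra and $\nu(B)=\int\kappa_P(B)\,d\tilde\nu(P)$, where $\tilde\nu$ is the image of $\nu$ on the set of plaques, and such that $\kappa_P$ is a probability measure concentrated on $P$ for $\tilde\nu$-almost every $P$. -/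

import Mathlib

open MeasureTheory

universe u

namespace OrbitFlow

variable {X : Type u} [TopologicalSpace X]

/-- The leaf topology on the orbit of `x`: the final topology for `t ↦ φ t x`, that is, the topology
of the line, of a circle or of a point, and not the one inherited from `X`. -/
abbrev leafTopology (φ : Flow ℝ X) (x : X) : TopologicalSpace (φ.orbit x) :=
  TopologicalSpace.coinduced (fun t : ℝ => (⟨φ t x, φ.mem_orbit x t⟩ : φ.orbit x)) inferInstance

/-- The orbit of `x` meets `A` in a set that is discrete for the leaf topology. -/
def DiscreteInLeaf (φ : Flow ℝ X) (x : X) (A : Set X) : Prop :=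
  @IsDiscrete (φ.orbit x) (leafTopology φ x) {y | (y : X) ∈ A}

/-- The (two-sided) orbit of `p` under the time-one map `φ 1`. -/
def timeOneOrbit (φ : Flow ℝ X) (p : X) : Set X :=
  Set.range fun n : ℤ => φ (n : ℝ) p

/-- `B` is the union of the time-one orbits of exactly `k` points, the `k` time-one orbits being
pairwise disjoint. -/
def IsTimeOneOrbitOfExactly (φ : Flow ℝ X) (k : ℕ) (B : Set X) : Prop :=
  ∃ p : Fin k → X, (Pairwise fun i j => Disjoint (timeOneOrbit φ (p i)) (timeOneOrbit φ (p j))) ∧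
    B = ⋃ i, timeOneOrbit φ (p i)

/-- The orbit segment `φ ([0, t] × {x})`. -/
def segment (φ : Flow ℝ X) (x : X) (t : ℝ) : Set X :=
  (fun τ : ℝ => φ τ x) '' Set.Icc 0 t

/-- A foliated chart for the partition of `X` into orbits: a homeomorphism of `S × (0, 1)` onto an
open subset of `X`, for some topological space `S`, that carries each `{s} × (0, 1)` onto an
injective orbit segment `φ (I × {x})` over an open interval `I`, bounded or not. -/
structure FoliatedChart (φ : Flow ℝ X) where
  Transversal : Type u
  [top : TopologicalSpace Transversal]
  toFun : Transversal × Set.Ioo (0 : ℝ) 1 → X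
  isOpenEmbedding : Topology.IsOpenEmbedding toFun
  plaque_eq : ∀ s : Transversal, ∃ (x : X) (I : Set ℝ), IsOpen I ∧ I.OrdConnected ∧
    Set.InjOn (fun t : ℝ => φ t x) I ∧
    (Set.range fun r : Set.Ioo (0 : ℝ) 1 => toFun (s, r)) = (fun t : ℝ => φ t x) '' I

namespace FoliatedChart

variable {φ : Flow ℝ X} (c : FoliatedChart φ)

/-- The open set covered by the chart. -/
def domain : Set X := Set.range c.toFun

/-- The plaque over `s`. -/
def plaque (s : c.Transversal) : Set X :=
  Set.range fun r : Set.Ioo (0 : ℝ) 1 => c.toFun (s, r)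

/-- A point of the plaque over `s`, used to name the leaf that contains this plaque. -/
noncomputable def basePoint (s : c.Transversal) : X :=
  c.toFun (s, ⟨1 / 2, by norm_num, by norm_num⟩)

/-- The projection of the domain onto the space of plaques. -/
noncomputable def proj (y : c.domain) : c.Transversal :=
  letI := c.top
  (c.isOpenEmbedding.toIsEmbedding.toHomeomorph.symm y).1

/-- The restriction to the plaque over `s` of the leafwise measure `m`, normalized, as a measure on
the domain of the chart. -/
noncomputable def plaqueMeasure [MeasurableSpace X] (m : X → Measure X) (s : c.Transversal) :
    Measure c.domain :=
  (m (c.basePoint s) (c.plaque s))⁻¹ •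
    ((m (c.basePoint s)).restrict (c.plaque s)).comap Subtype.val

end FoliatedChart

/-- `κ` is a system of conditional measures (a disintegration) of `ν` along the partition of `Y`
into the fibres of `π : Y → Q`. The set `Q` of fibres carries the quotient `σ`-algebra (a set is
measurable if and only if its preimage is) and the quotient measure `π_* ν`. -/
def IsDisintegration {Y Q : Type u} [MeasurableSpace Y] (ν : Measure Y) (π : Y → Q)
    (κ : Q → Measure Y) : Prop :=
  letI : MeasurableSpace Q := MeasurableSpace.map π inferInstance
  (∀ B : Set Y, MeasurableSet B → Measurable fun q => κ q B) ∧
  (∀ᵐ q ∂(ν.map π), κ q Set.univ = 1 ∧ κ q (π ⁻¹' {q})ᶜ = 0) ∧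
  (∀ B : Set Y, MeasurableSet B → ν B = ∫⁻ q, κ q B ∂(ν.map π))

/-- `m` is a leafwise system of conditional measures of `μ` along the orbits of `φ`: it assigns one
measure to each orbit and, in every foliated chart, the normalized restrictions of these measures to
the plaques form a disintegration of the restriction of `μ` to the domain of the chart. -/
def IsLeafwiseSystem [MeasurableSpace X] (φ : Flow ℝ X) (μ : Measure X) (m : X → Measure X) : Prop :=
  (∀ (t : ℝ) (x : X), m (φ t x) = m x) ∧
  ∀ c : FoliatedChart φ,
    IsDisintegration (μ.comap (Subtype.val : c.domain → X)) c.proj (c.plaqueMeasure m)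

end OrbitFlow

/-! The set `H` of times `t` for which `φ t` preserves `μ` is a closed subgroup of `ℝ` containing
`1`, so it is `ℝ` or `(1/n)ℤ`; this decides the alternative. If `μ` has an atom, recurrence makes
the atom periodic and `μ` lives on one finite orbit, so let `μ` be atomless.

Call a point generic if its empirical measures along a fixed subsequence of times converge weakly to
`μ`. Almost every point is generic, by the mean ergodic theorem and a diagonal extraction. The flow
carries genericity for `μ` to genericity for the image measure, and a point is generic for only one
probability measure (`eq_of_mem_genericSet`). Hence, for generic `x`, `φ t x` is generic exactly
when `t ∈ H` (`flow_mem_genericSet_iff`). If `H = (1/n)ℤ`, the generic points of an orbit are spaced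
by multiples of `1/n` in time and form `n` time-one orbits.

If `H = ℝ`, half of arc length is the leafwise measure. In a chart, a plaque is the set of points
reached from any of its points without leaving the domain. The involution `(y, t) ↦ (φ t y, -t)`
preserves `μ × dt`, and this mass transport (`lintegral_mul_stayVolume`) shows both that almost
every plaque has finite length and that normalized length disintegrates `μ`. -/

namespace OrbitFlow

open Set Filter Topology
open scoped ENNReal Pointwise

/-! ### Half of arc length along an orbit. -/

section LeafMeasure

variable {X : Type u} [TopologicalSpace X]

/-- The group of periods of `x`. -/
def periods (φ : Flow ℝ X) (x : X) : AddSubgroup ℝ where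
  carrier := {t | φ t x = x}
  zero_mem' := φ.map_zero_apply x
  add_mem' {a b} ha hb := by
    simp only [mem_ofPred_eq] at *
    rw [φ.map_add, hb, ha]
  neg_mem' {a} ha := by
    simp only [mem_ofPred_eq] at *
    nth_rewrite 1 [← ha]
    rw [← φ.map_add, neg_add_cancel, φ.map_zero_apply]

theorem mem_periods {φ : Flow ℝ X} {x : X} {t : ℝ} : t ∈ periods φ x ↔ φ t x = x := Iff.rfl

theorem flow_eq_flow_iff (φ : Flow ℝ X) (x : X) (s t : ℝ) :
    φ s x = φ t x ↔ s - t ∈ periods φ x := by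
  rw [mem_periods]
  constructor
  · intro h
    rw [sub_eq_neg_add, φ.map_add, h, ← φ.map_add, neg_add_cancel, φ.map_zero_apply]
  · intro h
    rw [← add_sub_cancel t s, φ.map_add, h]

theorem periods_flow (φ : Flow ℝ X) (t : ℝ) (x : X) : periods φ (φ t x) = periods φ x := by
  ext s
  rw [mem_periods, ← φ.map_add, flow_eq_flow_iff, add_sub_cancel_right]

theorem continuous_flow_time (φ : Flow ℝ X) (x : X) : Continuous fun t : ℝ => φ t x :=
  φ.continuous continuous_id continuous_const

theorem isClosed_periods [T1Space X] (φ : Flow ℝ X) (x : X) :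
    IsClosed (periods φ x : Set ℝ) :=
  isClosed_singleton.preimage (continuous_flow_time φ x)

/-- A closed proper subgroup of `ℝ` is cyclic. -/
theorem exists_eq_zmultiples_of_ne_top {Γ : AddSubgroup ℝ} (hc : IsClosed (Γ : Set ℝ))
    (h : Γ ≠ ⊤) : ∃ a, 0 ≤ a ∧ Γ = AddSubgroup.zmultiples a := by
  rcases Γ.dense_or_cyclic with hd | ⟨a, ha⟩
  · refine absurd ?_ h
    rw [← AddSubgroup.coe_eq_univ, ← hc.closure_eq, hd.closure_eq]
  · rw [← AddSubgroup.zmultiples_eq_closure] at ha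
    refine ⟨|a|, abs_nonneg a, ?_⟩
    rcases abs_choice a with h | h <;> rw [h, ha]
    rw [AddSubgroup.zmultiples_neg]

open Classical in
/-- A measurable fundamental domain for the translations by `Γ`, if there is one. -/
noncomputable def fundDomain (Γ : AddSubgroup ℝ) : Set ℝ :=
  if h : ∃ D : Set ℝ, MeasurableSet D ∧ IsAddFundamentalDomain Γ D volume then h.choose else ∅

theorem measurableSet_fundDomain (Γ : AddSubgroup ℝ) : MeasurableSet (fundDomain Γ) := by
  unfold fundDomain
  split_ifs with h
  · exact h.choose_spec.1
  · exact MeasurableSet.empty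

theorem isAddFundamentalDomain_fundDomain {a : ℝ} (ha : 0 ≤ a) :
    IsAddFundamentalDomain (AddSubgroup.zmultiples a) (fundDomain (AddSubgroup.zmultiples a))
      volume := by
  have h : ∃ D : Set ℝ, MeasurableSet D ∧
      IsAddFundamentalDomain (AddSubgroup.zmultiples a) D volume := by
    rcases ha.eq_or_lt with rfl | ha
    -- `a = 0` is the aperiodic case: the group is trivial and its domain is the whole line.
    · refine ⟨univ, MeasurableSet.univ, ?_⟩
      rw [AddSubgroup.zmultiples_zero_eq_bot]
      refine IsAddFundamentalDomain.mk' MeasurableSet.univ.nullMeasurableSet fun x => ?_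
      exact ⟨0, mem_univ _, fun _ _ => Subsingleton.elim _ _⟩
    · exact ⟨Ioc 0 (0 + a), measurableSet_Ioc, isAddFundamentalDomain_Ioc ha 0 volume⟩
  rw [fundDomain, dif_pos h]
  exact h.choose_spec.2

variable [MeasurableSpace X] [BorelSpace X]

/-- Half of the length measure on the orbit of `x`. -/
noncomputable def leafMeasure (φ : Flow ℝ X) (x : X) : Measure X :=
  (2⁻¹ : ℝ≥0∞) • (volume.restrict (fundDomain (periods φ x))).map fun t => φ t x

theorem leafMeasure_apply (φ : Flow ℝ X) (x : X) {S : Set X} (hS : MeasurableSet S) :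
    leafMeasure φ x S = 2⁻¹ * volume ({t | φ t x ∈ S} ∩ fundDomain (periods φ x)) := by
  have hm := (continuous_flow_time φ x).measurable
  rw [leafMeasure, Measure.smul_apply, Measure.map_apply hm hS,
    Measure.restrict_apply (hm hS), smul_eq_mul]
  rfl

variable [T2Space X]

/-- By injectivity, the translates of `J ∩ {t | φ t x ∈ S}` by the periods are disjoint, and since
`S` is covered by the image of `J` they tile `{t | φ t x ∈ S}`. This makes the measure computable
without the chosen fundamental domain. -/
theorem leafMeasure_eq_of_injOn (φ : Flow ℝ X) (x : X) (hx : periods φ x ≠ ⊤)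
    {S : Set X} (hS : MeasurableSet S) {J : Set ℝ} (hJ : MeasurableSet J)
    (hinj : InjOn (fun t => φ t x) J) (hSJ : S ⊆ (fun t => φ t x) '' J) :
    leafMeasure φ x S = 2⁻¹ * volume (J ∩ {t | φ t x ∈ S}) := by
  obtain ⟨a, ha, hΓ⟩ := exists_eq_zmultiples_of_ne_top (isClosed_periods φ x) hx
  have hD := isAddFundamentalDomain_fundDomain ha
  have hmem : ∀ {t : ℝ}, t ∈ AddSubgroup.zmultiples a ↔ φ t x = x := by
    intro t; rw [← hΓ, mem_periods]
  have hE : MeasurableSet {t | φ t x ∈ S} := (continuous_flow_time φ x).measurable hS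
  have hJE := hJ.inter hE
  rw [leafMeasure_apply φ x hS, hΓ, hD.measure_eq_tsum (J ∩ {t | φ t x ∈ S})]
  rw [← measure_iUnion, ← iUnion_inter]
  · congr 3
    ext s
    simp only [mem_ofPred_eq, mem_iUnion, mem_vadd_set]
    constructor
    · intro hs
      obtain ⟨t, htJ, hts⟩ := hSJ hs
      simp only at hts
      refine ⟨⟨s - t, ?_⟩, t, ⟨htJ, by simpa [hts] using hs⟩, ?_⟩
      · rw [← hΓ, ← flow_eq_flow_iff, hts]
      · change s - t + t = s
        ring
    · rintro ⟨g, t, ⟨-, ht⟩, rfl⟩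
      change φ ((g : ℝ) + t) x ∈ S
      rw [add_comm, φ.map_add, hmem.1 g.2]
      exact ht
  · intro g g' hgg'
    refine disjoint_left.2 ?_
    rintro s ⟨hs, -⟩ ⟨hs', -⟩
    obtain ⟨t, ht, rfl⟩ := mem_vadd_set.1 hs
    obtain ⟨t', ht', h⟩ := mem_vadd_set.1 hs'
    change (g' : ℝ) + t' = (g : ℝ) + t at h
    have htt : t = t' := by
      refine hinj ht.1 ht'.1 ?_
      simp only
      rw [flow_eq_flow_iff, hΓ]
      have : t - t' = g' - g := by linarith
      rw [this]
      exact sub_mem g'.2 g.2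
    subst htt
    exact hgg' (Subtype.ext (by linarith))
  · intro g
    exact (hJE.const_vadd g).inter (measurableSet_fundDomain _)

/-- Moving the base point translates the fundamental domain, and a set invariant under the periods
has the same measure in any two fundamental domains. -/
theorem leafMeasure_flow (φ : Flow ℝ X) (t : ℝ) (x : X) :
    leafMeasure φ (φ t x) = leafMeasure φ x := by
  by_cases hx : periods φ x = ⊤
  · have : t ∈ periods φ x := hx ▸ AddSubgroup.mem_top t
    rw [mem_periods.1 this]
  obtain ⟨a, ha, hΓ⟩ := exists_eq_zmultiples_of_ne_top (isClosed_periods φ x) hx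
  have hD := isAddFundamentalDomain_fundDomain ha
  have hmem : ∀ {t : ℝ}, t ∈ AddSubgroup.zmultiples a ↔ φ t x = x := by
    intro t; rw [← hΓ, mem_periods]
  ext S hS
  rw [leafMeasure_apply _ _ hS, leafMeasure_apply _ _ hS, periods_flow, hΓ]
  have hD' := hD.vadd_of_comm t
  have hE : MeasurableSet {t | φ t x ∈ S} := (continuous_flow_time φ x).measurable hS
  congr 1
  rw [hD.measure_set_eq hD' hE]
  · rw [← measure_vadd volume t, vadd_set_inter]
    congr 2
    ext s
    simp only [mem_vadd_set_iff_neg_vadd_mem, mem_ofPred_eq, vadd_eq_add, ← φ.map_add]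
    rw [neg_add_cancel_comm]
  · intro g
    ext s
    simp only [mem_preimage, mem_ofPred_eq]
    change φ ((g : ℝ) + s) x ∈ S ↔ _
    rw [add_comm, φ.map_add, hmem.1 g.2]

theorem measurePreserving_leafMeasure (φ : Flow ℝ X) (r : ℝ) (x : X) :
    MeasurePreserving (φ r) (leafMeasure φ x) (leafMeasure φ x) := by
  have hr : Measurable (φ r) := (φ.continuous_toFun r).measurable
  refine ⟨hr, ?_⟩
  conv_rhs => rw [← leafMeasure_flow φ r x]
  ext S hS
  rw [Measure.map_apply hr hS, leafMeasure_apply _ _ (hr hS), leafMeasure_apply _ _ hS,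
    periods_flow]
  simp only [mem_preimage, ← φ.map_add, add_comm]

theorem leafMeasure_ne_zero (φ : Flow ℝ X) (x : X) (hx : periods φ x ≠ ⊤) :
    leafMeasure φ x ≠ 0 := by
  obtain ⟨a, ha, hΓ⟩ := exists_eq_zmultiples_of_ne_top (isClosed_periods φ x) hx
  intro h
  have h1 : leafMeasure φ x univ = 0 := by rw [h]; rfl
  rw [leafMeasure_apply _ _ MeasurableSet.univ, hΓ] at h1
  have h2 := (isAddFundamentalDomain_fundDomain ha).measure_ne_zero (NeZero.ne volume)
  simp [h2] at h1

/-- An open set of times is a countable union of compact sets, whose images are compact, hence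
closed. -/
theorem measurableSet_image_flow_of_isOpen (φ : Flow ℝ X) (x : X) {I : Set ℝ} (hI : IsOpen I) :
    MeasurableSet ((fun t => φ t x) '' I) := by
  obtain ⟨F, hF, -, hU, -⟩ := hI.exists_iUnion_isClosed
  have h : I = ⋃ (m : ℕ) (n : ℕ), F m ∩ Metric.closedBall 0 n := by
    simp_rw [← inter_iUnion, Metric.iUnion_closedBall_nat, inter_univ, hU]
  simp_rw [h, image_iUnion]
  refine MeasurableSet.iUnion fun m => MeasurableSet.iUnion fun n => ?_
  exact (((isCompact_closedBall 0 _).inter_left (hF m)).image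
    (continuous_flow_time φ x)).isClosed.measurableSet

theorem leafMeasure_compl_orbit (φ : Flow ℝ X) (x : X) : leafMeasure φ x (φ.orbit x)ᶜ = 0 := by
  have ho : MeasurableSet (φ.orbit x) := by
    rw [φ.orbit_eq_range, ← image_univ]
    exact measurableSet_image_flow_of_isOpen φ x isOpen_univ
  rw [leafMeasure_apply _ _ ho.compl]
  have : {t | φ t x ∈ (φ.orbit x)ᶜ} = ∅ := by
    ext t
    simp [φ.mem_orbit x t]
  rw [this, empty_inter, measure_empty, mul_zero]

theorem leafMeasure_segment (φ : Flow ℝ X) (x : X) (hx : periods φ x ≠ ⊤) {t : ℝ}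
    (hinj : InjOn (fun τ : ℝ => φ τ x) (Icc 0 t)) :
    leafMeasure φ x (segment φ x t) = ENNReal.ofReal (t / 2) := by
  have hS : MeasurableSet (segment φ x t) :=
    (isCompact_Icc.image (continuous_flow_time φ x)).isClosed.measurableSet
  have hI : Icc 0 t ⊆ {τ | φ τ x ∈ segment φ x t} := fun s hs =>
    mem_image_of_mem (fun τ => φ τ x) hs
  rw [leafMeasure_eq_of_injOn φ x hx hS measurableSet_Icc hinj subset_rfl,
    inter_eq_left.2 hI, Real.volume_Icc, sub_zero,
    div_eq_inv_mul, ENNReal.ofReal_mul (by norm_num), ENNReal.ofReal_inv_of_pos (by norm_num)]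
  norm_num

end LeafMeasure

/-! ### Times during which an orbit remains in a set. -/

section StayTimes

variable {X : Type u} [TopologicalSpace X]

/-- The times `t` such that the orbit of `y` stays in `U` between the times `0` and `t`. -/
def stayTimes (φ : Flow ℝ X) (U : Set X) (y : X) : Set ℝ :=
  {t | ∀ s ∈ uIcc 0 t, φ s y ∈ U}

theorem zero_mem_stayTimes {φ : Flow ℝ X} {U : Set X} {y : X} (hy : y ∈ U) :
    (0 : ℝ) ∈ stayTimes φ U y := by
  intro s hs
  rw [uIcc_self, mem_singleton_iff] at hs
  rwa [hs, φ.map_zero_apply]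

theorem flow_mem_of_mem_stayTimes {φ : Flow ℝ X} {U : Set X} {y : X} {t : ℝ}
    (ht : t ∈ stayTimes φ U y) : φ t y ∈ U :=
  ht t right_mem_uIcc

theorem mem_of_mem_stayTimes {φ : Flow ℝ X} {U : Set X} {y : X} {t : ℝ}
    (ht : t ∈ stayTimes φ U y) : y ∈ U := by
  simpa using ht 0 left_mem_uIcc

theorem neg_mem_stayTimes {φ : Flow ℝ X} {U : Set X} {y : X} {t : ℝ}
    (ht : t ∈ stayTimes φ U y) : -t ∈ stayTimes φ U (φ t y) := by
  intro s hs
  rw [← φ.map_add]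
  refine ht _ ?_
  rw [mem_uIcc] at hs ⊢
  rcases hs with h | h
  · exact Or.inr ⟨by linarith, by linarith⟩
  · exact Or.inl ⟨by linarith, by linarith⟩

theorem neg_mem_stayTimes_iff {φ : Flow ℝ X} {U : Set X} {y : X} {t : ℝ} :
    -t ∈ stayTimes φ U (φ t y) ↔ t ∈ stayTimes φ U y := by
  refine ⟨fun h => ?_, neg_mem_stayTimes⟩
  have := neg_mem_stayTimes h
  rwa [← φ.map_add, neg_add_cancel, φ.map_zero_apply, neg_neg] at this

/-- Writing the times between `0` and `t` as `r * t` with `r ∈ [0, 1]` fixes the compact parameter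
set, so the tube lemma applies. -/
theorem isOpen_setOf_mem_stayTimes (φ : Flow ℝ X) {U : Set X} (hU : IsOpen U) :
    IsOpen {p : X × ℝ | p.2 ∈ stayTimes φ U p.1} := by
  have h : {p : X × ℝ | p.2 ∈ stayTimes φ U p.1} =
      {p : X × ℝ | ∀ r ∈ Icc (0 : ℝ) 1, φ (r * p.2) p.1 ∈ U} := by
    ext ⟨y, t⟩
    have : uIcc 0 t = (fun r => r * t) '' Icc (0 : ℝ) 1 := by
      rw [← segment_eq_uIcc, segment_eq_image]
      simp
    simp only [mem_ofPred_eq, stayTimes, this, forall_mem_image]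
  rw [h, isOpen_iff_mem_nhds]
  intro p hp
  refine isCompact_Icc.eventually_forall_of_forall_eventually fun r hr => ?_
  have hc : Continuous fun z : (X × ℝ) × ℝ => φ (z.2 * z.1.2) z.1.1 := by fun_prop
  exact hc.continuousAt.eventually (hU.mem_nhds (hp r hr))

theorem isOpen_stayTimes (φ : Flow ℝ X) {U : Set X} (hU : IsOpen U) (y : X) :
    IsOpen (stayTimes φ U y) :=
  (isOpen_setOf_mem_stayTimes φ hU).preimage (Continuous.prodMk_right y)

end StayTimes

/-! ### Plaques as orbit segments described by stay times. -/

namespace FoliatedChart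

variable {X : Type u} [TopologicalSpace X] {φ : Flow ℝ X} (c : FoliatedChart φ)

instance : TopologicalSpace c.Transversal := c.top

theorem isOpen_domain : IsOpen c.domain := c.isOpenEmbedding.isOpen_range

theorem proj_toFun (p : c.Transversal × Ioo (0 : ℝ) 1) (h : c.toFun p ∈ c.domain) :
    c.proj ⟨c.toFun p, h⟩ = p.1 := by
  have : (⟨c.toFun p, h⟩ : c.domain) = c.isOpenEmbedding.toIsEmbedding.toHomeomorph p := rfl
  rw [proj, this, Homeomorph.symm_apply_apply]

theorem plaque_subset_domain (s : c.Transversal) : c.plaque s ⊆ c.domain := by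
  rintro _ ⟨r, rfl⟩
  exact mem_range_self _

theorem mem_plaque_iff (y : c.domain) (s : c.Transversal) :
    (y : X) ∈ c.plaque s ↔ c.proj y = s := by
  obtain ⟨_, hy⟩ := y
  obtain ⟨p, rfl⟩ := id hy
  rw [proj_toFun]
  constructor
  · rintro ⟨r, hr⟩
    rw [← c.isOpenEmbedding.injective hr]
  · rintro rfl
    exact ⟨p.2, rfl⟩

theorem eq_of_mem_plaque {z : X} {s s' : c.Transversal} (h : z ∈ c.plaque s)
    (h' : z ∈ c.plaque s') : s = s' := by
  have hz := c.plaque_subset_domain s h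
  exact ((c.mem_plaque_iff ⟨z, hz⟩ s).1 h).symm.trans ((c.mem_plaque_iff ⟨z, hz⟩ s').1 h')

/-- The second coordinate of a point of the domain of the chart. -/
noncomputable def height : X → ℝ :=
  Function.extend c.toFun (fun p => (p.2 : ℝ)) 0

theorem height_toFun (p : c.Transversal × Ioo (0 : ℝ) 1) : c.height (c.toFun p) = p.2 :=
  c.isOpenEmbedding.injective.extend_apply _ _ p

theorem continuousAt_height {z : X} (hz : z ∈ c.domain) : ContinuousAt c.height z := by
  obtain ⟨p, rfl⟩ := hz
  rw [← c.isOpenEmbedding.continuousAt_iff]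
  have : c.height ∘ c.toFun = fun p => (p.2 : ℝ) := funext c.height_toFun
  rw [this]
  fun_prop

theorem height_mem {z : X} (hz : z ∈ c.domain) : c.height z ∈ Ioo (0 : ℝ) 1 := by
  obtain ⟨p, rfl⟩ := hz
  rw [height_toFun]
  exact p.2.2

theorem eq_of_height_eq {s : c.Transversal} {z z' : X} (hz : z ∈ c.plaque s)
    (hz' : z' ∈ c.plaque s) (h : c.height z = c.height z') : z = z' := by
  obtain ⟨r, rfl⟩ := hz
  obtain ⟨r', rfl⟩ := hz'
  simp only [height_toFun] at h
  rw [Subtype.ext h]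

/-- Along a plaque, the times at which the height belongs to a compact subinterval of `(0, 1)` lie
in a compact interval of times. -/
theorem exists_uIcc_of_height_mem {s : c.Transversal} {x : X} {I : Set ℝ} (hI : I.OrdConnected)
    (hinj : InjOn (fun t : ℝ => φ t x) I) (hp : c.plaque s = (fun t : ℝ => φ t x) '' I)
    {a b : ℝ} (ha : a ∈ Ioo (0 : ℝ) 1) (hb : b ∈ Ioo (0 : ℝ) 1) :
    ∃ t₁ ∈ I, ∃ t₂ ∈ I, ∀ t ∈ I, c.height (φ t x) ∈ uIcc a b → t ∈ uIcc t₁ t₂ := by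
  have key : ∀ r ∈ Ioo (0 : ℝ) 1, ∃ t ∈ I, c.height (φ t x) = r := by
    intro r hr
    have h : c.toFun (s, ⟨r, hr⟩) ∈ c.plaque s := mem_range_self _
    rw [hp] at h
    obtain ⟨t, ht, h⟩ := h
    exact ⟨t, ht, by simp only at h; rw [h, height_toFun]⟩
  have hmem : ∀ t ∈ I, φ t x ∈ c.plaque s := fun t ht => hp ▸ mem_image_of_mem _ ht
  obtain ⟨t₁, ht₁, h₁⟩ := key a ha
  obtain ⟨t₂, ht₂, h₂⟩ := key b hb
  refine ⟨t₁, ht₁, t₂, ht₂, fun t ht h => ?_⟩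
  have hsub := hI.uIcc_subset ht₁ ht₂
  have hc : ContinuousOn (fun t => c.height (φ t x)) (uIcc t₁ t₂) := by
    intro t ht
    have := c.continuousAt_height (c.plaque_subset_domain s (hmem t (hsub ht)))
    exact (ContinuousAt.comp (f := fun t => φ t x) this
      (continuous_flow_time φ x).continuousAt).continuousWithinAt
  -- Some time between `t₁` and `t₂` has the same height as `t`; height separates the points of a
  -- plaque and the flow is injective on `I`, so that time is `t`.
  rw [← h₁, ← h₂] at h
  obtain ⟨t', ht', h'⟩ := intermediate_value_uIcc hc h
  have := hinj (hsub ht') ht (c.eq_of_height_eq (hmem _ (hsub ht')) (hmem _ ht) h')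
  exact this ▸ ht'

/-- An orbit cannot leave a plaque while remaining in the domain. The times in `I` form an open set,
and they are also closed among the stay times: at a limit time the height is still in `(0, 1)`, so
the nearby times of `I` lie in a compact subinterval of `I`, which contains the limit. -/
theorem stayTimes_eq {s : c.Transversal} {x : X} {I : Set ℝ} (hIo : IsOpen I)
    (hI : I.OrdConnected)
    (hinj : InjOn (fun t : ℝ => φ t x) I) (hp : c.plaque s = (fun t : ℝ => φ t x) '' I)
    {t₀ : ℝ} (ht₀ : t₀ ∈ I) :
    stayTimes φ c.domain (φ t₀ x) = {t | t₀ + t ∈ I} := by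
  have hmem : ∀ t ∈ I, φ t x ∈ c.plaque s := fun t ht => hp ▸ mem_image_of_mem _ ht
  apply Subset.antisymm
  · intro t ht
    have hcont : Continuous fun t : ℝ => t₀ + t := by fun_prop
    have hu : IsOpen {t | t₀ + t ∈ I} := hIo.preimage hcont
    refine isPreconnected_uIcc.subset_of_closure_inter_subset hu (s := uIcc 0 t)
      ⟨0, left_mem_uIcc, by simpa using ht₀⟩ ?_ right_mem_uIcc
    rintro r ⟨hr, hrt⟩
    have hflow : ∀ q, φ q (φ t₀ x) = φ (t₀ + q) x := fun q => by rw [add_comm, φ.map_add]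
    have hz := ht r hrt
    rw [hflow] at hz
    have hfreq : ∃ᶠ q in 𝓝 r, t₀ + q ∈ I := mem_closure_iff_frequently.1 hr
    have hzs : φ (t₀ + r) x ∈ c.plaque s := by
      have hz' := (c.mem_plaque_iff ⟨_, hz⟩ _).2 rfl
      generalize c.proj ⟨_, hz⟩ = s' at hz'
      simp only at hz'
      obtain ⟨x', I', hIo', -, -, hp'⟩ := c.plaque_eq s'
      change c.plaque s' = _ at hp'
      have hz'' := hz'
      rw [hp'] at hz''
      obtain ⟨i, hi, hix⟩ := hz''
      simp only at hix
      have hev : ∀ᶠ q in 𝓝 r, i + (q - r) ∈ I' := by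
        have : ContinuousAt (fun q : ℝ => i + (q - r)) r := by fun_prop
        exact this.eventually (hIo'.mem_nhds (by simpa using hi))
      obtain ⟨q, hq, hq'⟩ := (hfreq.and_eventually hev).exists
      have h1 : φ (t₀ + q) x = φ (i + (q - r)) x' := by
        rw [show t₀ + q = (q - r) + (t₀ + r) by ring, φ.map_add, ← hix, ← φ.map_add, add_comm]
      have h2 : φ (t₀ + q) x ∈ c.plaque s' := by
        rw [h1, hp']
        exact mem_image_of_mem _ hq'
      rwa [c.eq_of_mem_plaque (hmem _ hq) h2]
    obtain ⟨h0, h1⟩ := c.height_mem hz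
    obtain ⟨a, ha0, ha⟩ := exists_between h0
    obtain ⟨b, hb, hb1⟩ := exists_between h1
    obtain ⟨t₁, ht₁, t₂, ht₂, hw⟩ := c.exists_uIcc_of_height_mem hI hinj hp
      (a := a) (b := b) ⟨ha0, by linarith⟩ ⟨by linarith, hb1⟩
    have hev : ∀ᶠ q in 𝓝 r, c.height (φ (t₀ + q) x) ∈ uIcc a b := by
      have h2 : ContinuousAt (fun q => φ (t₀ + q) x) r :=
        ((continuous_flow_time φ x).comp hcont).continuousAt
      have h3 : ContinuousAt (fun q => c.height (φ (t₀ + q) x)) r :=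
        ContinuousAt.comp (f := fun q => φ (t₀ + q) x) (c.continuousAt_height hz) h2
      refine h3.eventually ?_
      rw [uIcc_of_le (by linarith)]
      exact Icc_mem_nhds ha hb
    have hfr : ∃ᶠ q in 𝓝 r, t₀ + q ∈ uIcc t₁ t₂ :=
      (hfreq.and_eventually hev).mono fun q hq => hw _ hq.1 hq.2
    have hcl : IsClosed {q : ℝ | t₀ + q ∈ uIcc t₁ t₂} := isClosed_Icc.preimage hcont
    have : r ∈ {q : ℝ | t₀ + q ∈ uIcc t₁ t₂} := by
      rw [← hcl.closure_eq]
      exact mem_closure_iff_frequently.2 hfr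
    exact hI.uIcc_subset ht₁ ht₂ this
  · intro t ht r hr
    rw [← φ.map_add]
    refine c.plaque_subset_domain s (hmem _ (hI.uIcc_subset ht₀ ht ?_))
    rw [mem_uIcc] at hr ⊢
    rcases hr with h | h
    · exact Or.inl ⟨by linarith, by linarith⟩
    · exact Or.inr ⟨by linarith, by linarith⟩

/-- The structure of the plaque of `y`, seen from `y`. -/
theorem stayTimes_spec (y : c.domain) :
    (stayTimes φ c.domain y).OrdConnected ∧
    InjOn (fun t : ℝ => φ t y) (stayTimes φ c.domain y) ∧
    c.plaque (c.proj y) = (fun t : ℝ => φ t y) '' stayTimes φ c.domain y := by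
  obtain ⟨x, I, hIo, hI, hinj, hp⟩ := c.plaque_eq (c.proj y)
  change c.plaque (c.proj y) = _ at hp
  have hy := (c.mem_plaque_iff y _).2 rfl
  rw [hp] at hy
  obtain ⟨t₀, ht₀, hy⟩ := hy
  simp only at hy
  have hst := c.stayTimes_eq hIo hI hinj hp ht₀
  rw [← hy, hst, hp]
  have hflow : ∀ q, φ q (φ t₀ x) = φ (t₀ + q) x := fun q => by rw [add_comm, φ.map_add]
  refine ⟨⟨fun a ha b hb r hr => hI.out ha hb ⟨?_, ?_⟩⟩, ?_, ?_⟩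
  · linarith [hr.1]
  · linarith [hr.2]
  · intro a ha b hb hab
    simp only [hflow] at hab
    have := hinj ha hb hab
    linarith
  · simp only [hflow]
    ext z
    constructor
    · rintro ⟨t, ht, rfl⟩
      exact ⟨t - t₀, by simpa using ht, by simp⟩
    · rintro ⟨t, ht, rfl⟩
      exact ⟨t₀ + t, ht, rfl⟩

theorem periods_ne_top (y : c.domain) : periods φ y ≠ ⊤ := by
  intro h
  have h0 := (isOpen_stayTimes φ c.isOpen_domain y).mem_nhds (zero_mem_stayTimes y.2)
  obtain ⟨t, ht, ht0⟩ := ((eventually_nhdsWithin_of_eventually_nhds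
    (s := {0}ᶜ) (eventually_mem_set.2 h0)).and self_mem_nhdsWithin).exists
  have hp : ∀ t : ℝ, φ t y = y := fun t => by
    rw [← mem_periods, h]
    exact AddSubgroup.mem_top t
  exact ht0 ((c.stayTimes_spec y).2.1 ht (zero_mem_stayTimes y.2) (by simp only [hp]))

theorem proj_flow (y : c.domain) {t : ℝ} (ht : t ∈ stayTimes φ c.domain y) :
    c.proj ⟨φ t y, flow_mem_of_mem_stayTimes ht⟩ = c.proj y := by
  rw [← mem_plaque_iff, (c.stayTimes_spec y).2.2]
  exact mem_image_of_mem _ ht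

variable [T2Space X] [MeasurableSpace X] [BorelSpace X]

theorem leafMeasure_plaque_inter (y : c.domain) {B : Set X} (hB : MeasurableSet B) :
    leafMeasure φ y (c.plaque (c.proj y) ∩ B) =
      2⁻¹ * volume (stayTimes φ c.domain y ∩ {t | φ t y ∈ B}) := by
  obtain ⟨-, hinj, hp⟩ := c.stayTimes_spec y
  have hO := isOpen_stayTimes φ c.isOpen_domain y
  have hm : MeasurableSet (c.plaque (c.proj y)) := by
    rw [hp]
    exact measurableSet_image_flow_of_isOpen φ y hO
  rw [leafMeasure_eq_of_injOn φ y (c.periods_ne_top y) (hm.inter hB) hO.measurableSet hinj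
    (inter_subset_left.trans hp.subset)]
  congr 2
  ext t
  simp only [mem_inter_iff, mem_ofPred_eq, and_congr_right_iff, and_iff_right_iff_imp]
  intro ht _
  rw [hp]
  exact mem_image_of_mem _ ht

end FoliatedChart

/-! ### Mass transport along a measure-preserving flow. -/

section MassTransport

variable {X : Type u} [TopologicalSpace X]

/-- The measure of the set of times at which the orbit of `y` is in `B`, without having left `U`. -/
noncomputable def stayVolume (φ : Flow ℝ X) (U B : Set X) (y : X) : ℝ≥0∞ :=
  volume (stayTimes φ U y ∩ {t | φ t y ∈ B})

theorem stayVolume_of_notMem (φ : Flow ℝ X) {U : Set X} (B : Set X) {y : X} (hy : y ∉ U) :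
    stayVolume φ U B y = 0 := by
  have : stayTimes φ U y = ∅ := eq_empty_of_forall_notMem fun t ht => hy (mem_of_mem_stayTimes ht)
  rw [stayVolume, this, empty_inter, measure_empty]

variable [MeasurableSpace X] [BorelSpace X]

theorem measurable_stayVolume (φ : Flow ℝ X) {U B : Set X} (hU : IsOpen U) (hB : MeasurableSet B) :
    Measurable (stayVolume φ U B) := by
  have hc : Continuous fun p : X × ℝ => φ p.2 p.1 := by fun_prop
  exact measurable_measure_prodMk_left (ν := (volume : Measure ℝ))
    ((isOpen_setOf_mem_stayTimes φ hU).measurableSet.inter (hc.measurable hB))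

/-- Tonelli's theorem, the reflection `t ↦ -t` and the invariance of `μ` under each `φ t`. -/
theorem lintegral_lintegral_flow (φ : Flow ℝ X) (μ : Measure X) [SFinite μ]
    (hμ : ∀ t, MeasurePreserving (φ t) μ μ) {G : X × ℝ → ℝ≥0∞} (hG : Measurable G) :
    ∫⁻ y, (∫⁻ t : ℝ, G (y, t)) ∂μ = ∫⁻ z, (∫⁻ t : ℝ, G (φ t z, -t)) ∂μ := by
  have hc : Continuous fun p : X × ℝ => φ p.2 p.1 := by fun_prop
  have hG' : Measurable fun p : X × ℝ => G (φ p.2 p.1, -p.2) :=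
    hG.comp (hc.measurable.prodMk measurable_snd.neg)
  rw [lintegral_lintegral_swap (f := fun y t => G (y, t)) hG.aemeasurable,
    lintegral_lintegral_swap (f := fun z t => G (φ t z, -t)) hG'.aemeasurable,
    ← (Measure.measurePreserving_neg (volume : Measure ℝ)).lintegral_comp]
  · refine lintegral_congr fun t => ?_
    rw [← (hμ t).lintegral_comp]
    exact hG.comp measurable_prodMk_right
  · exact hG.lintegral_prod_left'

/-- Each `y` sends mass with density `w y` to the points of `B` that it reaches inside `U`.
Reachability is symmetric and preserves `w`, so the right side is the total mass received. -/
theorem lintegral_mul_stayVolume (φ : Flow ℝ X) (μ : Measure X) [SFinite μ]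
    (hμ : ∀ t, MeasurePreserving (φ t) μ μ) {U B : Set X} (hU : IsOpen U) (hB : MeasurableSet B)
    {w : X → ℝ≥0∞} (hw : Measurable w)
    (hinv : ∀ y, ∀ t ∈ stayTimes φ U y, w (φ t y) = w y) :
    ∫⁻ y, w y * stayVolume φ U B y ∂μ = ∫⁻ z in B, w z * stayVolume φ U univ z ∂μ := by
  have hc : Continuous fun p : X × ℝ => φ p.2 p.1 := by fun_prop
  have hR := (isOpen_setOf_mem_stayTimes φ hU).measurableSet
  have hRB : MeasurableSet {p : X × ℝ | p.2 ∈ stayTimes φ U p.1 ∧ φ p.2 p.1 ∈ B} :=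
    hR.inter (hc.measurable hB)
  have hG : Measurable ({p : X × ℝ | p.2 ∈ stayTimes φ U p.1 ∧ φ p.2 p.1 ∈ B}.indicator
      fun p => w p.1) := (hw.comp measurable_fst).indicator hRB
  have h := lintegral_lintegral_flow φ μ hμ hG
  have hl : ∀ y, ∫⁻ t : ℝ, {p : X × ℝ | p.2 ∈ stayTimes φ U p.1 ∧ φ p.2 p.1 ∈ B}.indicator
      (fun p => w p.1) (y, t) = w y * stayVolume φ U B y := by
    intro y
    have : MeasurableSet (stayTimes φ U y ∩ {t | φ t y ∈ B}) :=
      (isOpen_stayTimes φ hU y).measurableSet.inter ((continuous_flow_time φ y).measurable hB)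
    rw [stayVolume, ← lintegral_indicator_const this]
    rfl
  have hr : ∀ z, ∫⁻ t : ℝ, {p : X × ℝ | p.2 ∈ stayTimes φ U p.1 ∧ φ p.2 p.1 ∈ B}.indicator
      (fun p => w p.1) (φ t z, -t) = B.indicator (fun z => w z * stayVolume φ U univ z) z := by
    intro z
    have hm : MeasurableSet (stayTimes φ U z) := (isOpen_stayTimes φ hU z).measurableSet
    have hu : stayVolume φ U univ z = volume (stayTimes φ U z) := by simp [stayVolume]
    have hback : ∀ t, φ (-t) (φ t z) = z := fun t => by
      rw [← φ.map_add, neg_add_cancel, φ.map_zero_apply]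
    by_cases hz : z ∈ B
    · rw [indicator_of_mem hz, hu, ← lintegral_indicator_const hm]
      refine lintegral_congr fun t => ?_
      by_cases ht : t ∈ stayTimes φ U z
      · rw [indicator_of_mem ht, indicator_of_mem]
        · exact hinv z t ht
        · exact ⟨neg_mem_stayTimes ht, by simpa only [hback] using hz⟩
      · rw [indicator_of_notMem ht, indicator_of_notMem]
        exact fun h => ht (neg_mem_stayTimes_iff.1 h.1)
    · rw [indicator_of_notMem hz, ← lintegral_zero (μ := (volume : Measure ℝ))]
      refine lintegral_congr fun t => ?_
      rw [indicator_of_notMem]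
      intro h
      exact hz (by simpa only [hback] using h.2)
  simp_rw [hl, hr] at h
  rw [h, lintegral_indicator hB]

end MassTransport

/-! ### Disintegration of an invariant measure in a chart. -/

namespace FoliatedChart

variable {X : Type u} [TopologicalSpace X] {φ : Flow ℝ X} (c : FoliatedChart φ)

/-- The points whose height is in `(1/4, 3/4)`. -/
noncomputable def window : Set X := c.domain ∩ c.height ⁻¹' Ioo (1 / 4) (3 / 4)

theorem isOpen_window : IsOpen c.window :=
  ContinuousOn.isOpen_inter_preimage
    (fun _ hz => (c.continuousAt_height hz).continuousWithinAt) c.isOpen_domain isOpen_Ioo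

theorem stayVolume_univ_ne_zero {y : X} (hy : y ∈ c.domain) :
    stayVolume φ c.domain univ y ≠ 0 := by
  simp only [stayVolume, mem_univ, ofPred_true, inter_univ]
  exact (isOpen_stayTimes φ c.isOpen_domain y).measure_ne_zero _ ⟨0, zero_mem_stayTimes hy⟩

theorem stayVolume_window_ne_zero {y : X} (hy : y ∈ c.domain) :
    stayVolume φ c.domain c.window y ≠ 0 := by
  refine ((isOpen_stayTimes φ c.isOpen_domain y).inter
    (c.isOpen_window.preimage (continuous_flow_time φ y))).measure_ne_zero _ ?_
  have h : c.basePoint (c.proj ⟨y, hy⟩) ∈ c.plaque (c.proj ⟨y, hy⟩) := mem_range_self _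
  rw [(c.stayTimes_spec ⟨y, hy⟩).2.2] at h
  obtain ⟨t, ht, h⟩ := h
  simp only at h
  refine ⟨t, ht, flow_mem_of_mem_stayTimes ht, ?_⟩
  simp only [mem_preimage]
  rw [h, basePoint, height_toFun]
  constructor <;> norm_num

theorem stayVolume_window_ne_top {y : X} (hy : y ∈ c.domain) :
    stayVolume φ c.domain c.window y ≠ ∞ := by
  obtain ⟨hI, hinj, hp⟩ := c.stayTimes_spec ⟨y, hy⟩
  obtain ⟨t₁, -, t₂, -, h⟩ := c.exists_uIcc_of_height_mem hI hinj hp (a := 1 / 4) (b := 3 / 4)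
    (by constructor <;> norm_num) (by constructor <;> norm_num)
  refine ne_top_of_le_ne_top (b := volume (uIcc t₁ t₂)) ?_ (measure_mono ?_)
  · exact isCompact_uIcc.measure_ne_top
  · rintro t ⟨ht, htw⟩
    refine h t ht ?_
    rw [uIcc_of_le (by norm_num)]
    exact Ioo_subset_Icc_self htw.2

variable [T2Space X] [MeasurableSpace X] [BorelSpace X]

theorem measurableSet_plaque (y : c.domain) : MeasurableSet (c.plaque (c.proj y)) := by
  rw [(c.stayTimes_spec y).2.2]
  exact measurableSet_image_flow_of_isOpen φ y (isOpen_stayTimes φ c.isOpen_domain y)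

theorem leafMeasure_basePoint (y : c.domain) :
    leafMeasure φ (c.basePoint (c.proj y)) = leafMeasure φ y := by
  have h : c.basePoint (c.proj y) ∈ c.plaque (c.proj y) := mem_range_self _
  rw [(c.stayTimes_spec y).2.2] at h
  obtain ⟨t, -, h⟩ := h
  simp only at h
  rw [← h, leafMeasure_flow]

theorem leafMeasure_plaque_inter' (y : c.domain) {B : Set X} (hB : MeasurableSet B) :
    leafMeasure φ (c.basePoint (c.proj y)) (c.plaque (c.proj y) ∩ B) =
      2⁻¹ * stayVolume φ c.domain B y := by
  rw [leafMeasure_basePoint, leafMeasure_plaque_inter c y hB, stayVolume]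

/-- Both sides are twice the leafwise measure of `B` in one and the same plaque. -/
theorem stayVolume_flow {B : Set X} (hB : MeasurableSet B) (y : X) {t : ℝ}
    (ht : t ∈ stayTimes φ c.domain y) :
    stayVolume φ c.domain B (φ t y) = stayVolume φ c.domain B y := by
  have h := c.leafMeasure_plaque_inter' ⟨y, mem_of_mem_stayTimes ht⟩ hB
  rw [← c.proj_flow ⟨y, mem_of_mem_stayTimes ht⟩ ht, c.leafMeasure_plaque_inter' _ hB] at h
  exact (ENNReal.mul_right_inj (by simp) (by simp)).1 h

/-- Almost every plaque has finite length. -/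
theorem ae_stayVolume_ne_top (μ : Measure X) [IsFiniteMeasure μ]
    (hμ : ∀ t, MeasurePreserving (φ t) μ μ) :
    ∀ᵐ y ∂μ, stayVolume φ c.domain univ y ≠ ∞ := by
  have hL := measurable_stayVolume φ c.isOpen_domain MeasurableSet.univ
  have hl := measurable_stayVolume φ c.isOpen_domain c.isOpen_window.measurableSet
  have hW : MeasurableSet {y | stayVolume φ c.domain univ y = ∞} := hL (measurableSet_singleton ∞)
  have hWU : ∀ y, stayVolume φ c.domain univ y = ∞ → y ∈ c.domain := by
    intro y hy
    by_contra hyU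
    simp [stayVolume_of_notMem φ _ hyU] at hy
  rw [ae_iff]
  simp only [not_not]
  set W := {y | stayVolume φ c.domain univ y = ∞} with hWdef
  -- The weight is the inverse length of the window in the plaque, which is finite even when the
  -- plaque is infinite. Mass transport then equates `μ W` with `∞` times an integral; as `μ` is
  -- finite, `μ W = 0`.
  have hw : Measurable (W.indicator fun y => (stayVolume φ c.domain c.window y)⁻¹) :=
    hl.inv.indicator hW
  have h := lintegral_mul_stayVolume φ μ hμ c.isOpen_domain c.isOpen_window.measurableSet hw (by
    intro y t ht
    have h1 := c.stayVolume_flow MeasurableSet.univ y ht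
    have h2 := c.stayVolume_flow c.isOpen_window.measurableSet y ht
    simp only [indicator, hWdef, mem_ofPred_eq, h1, h2])
  have hleft : ∫⁻ y, W.indicator (fun y => (stayVolume φ c.domain c.window y)⁻¹) y *
      stayVolume φ c.domain c.window y ∂μ = μ W := by
    rw [← lintegral_indicator_one hW]
    refine lintegral_congr fun y => ?_
    by_cases hy : y ∈ W
    · rw [indicator_of_mem hy, indicator_of_mem hy, ENNReal.inv_mul_cancel
        (c.stayVolume_window_ne_zero (hWU y hy)) (c.stayVolume_window_ne_top (hWU y hy))]
      rfl
    · simp [hy]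
  have hright : ∫⁻ z in c.window, W.indicator (fun y => (stayVolume φ c.domain c.window y)⁻¹) z *
      stayVolume φ c.domain univ z ∂μ = ∞ * ∫⁻ z in c.window,
        W.indicator (fun y => (stayVolume φ c.domain c.window y)⁻¹) z ∂μ := by
    rw [← lintegral_const_mul _ hw]
    refine lintegral_congr fun y => ?_
    by_cases hy : y ∈ W
    · rw [show stayVolume φ c.domain univ y = ∞ from hy, mul_comm]
    · simp [hy]
  rw [hleft, hright] at h
  by_contra hne
  have hne' : ∫⁻ z in c.window,
      W.indicator (fun y => (stayVolume φ c.domain c.window y)⁻¹) z ∂μ ≠ 0 := by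
    intro h0
    rw [h0, mul_zero] at h
    exact hne h
  rw [ENNReal.top_mul hne'] at h
  exact measure_ne_top μ W h

/-- The factor `1/2` in `leafMeasure` cancels under normalization. -/
theorem plaqueMeasure_proj (y : c.domain) {B : Set c.domain} (hB : MeasurableSet B) :
    c.plaqueMeasure (leafMeasure φ) (c.proj y) B =
      (stayVolume φ c.domain univ y)⁻¹ * stayVolume φ c.domain (Subtype.val '' B) y := by
  have hU := c.isOpen_domain.measurableSet
  have hB' : MeasurableSet (Subtype.val '' B) := hU.subtype_image hB
  have h1 := c.leafMeasure_plaque_inter' y MeasurableSet.univ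
  rw [inter_univ] at h1
  rw [plaqueMeasure, Measure.smul_apply, comap_subtype_coe_apply hU,
    Measure.restrict_apply hB', inter_comm, c.leafMeasure_plaque_inter' y hB', h1, smul_eq_mul,
    ENNReal.mul_inv (by simp) (by simp), inv_inv, mul_mul_mul_comm, ENNReal.mul_inv_cancel,
    one_mul]
  · simp
  · simp

theorem isDisintegration_plaqueMeasure (μ : Measure X) [IsFiniteMeasure μ]
    (hμ : ∀ t, MeasurePreserving (φ t) μ μ) :
    IsDisintegration (μ.comap (Subtype.val : c.domain → X)) c.proj
      (c.plaqueMeasure (leafMeasure φ)) := by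
  let _ : MeasurableSpace c.Transversal := MeasurableSpace.map c.proj inferInstance
  have hU := c.isOpen_domain.measurableSet
  have hproj : Measurable c.proj := fun S hS => hS
  have hmeas : ∀ B : Set c.domain, MeasurableSet B →
      Measurable fun q => c.plaqueMeasure (leafMeasure φ) q B := by
    intro B hB
    suffices h : Measurable fun y => c.plaqueMeasure (leafMeasure φ) (c.proj y) B from
      fun S hS => h hS
    simp_rw [c.plaqueMeasure_proj _ hB]
    exact ((measurable_stayVolume φ c.isOpen_domain MeasurableSet.univ).inv.mul
      (measurable_stayVolume φ c.isOpen_domain (hU.subtype_image hB))).comp measurable_subtype_coe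
  have hfin := c.ae_stayVolume_ne_top μ hμ
  refine ⟨hmeas, ?_, ?_⟩
  · refine Filter.Eventually.and ?_ ?_
    · refine (ae_map_iff hproj.aemeasurable
        (hmeas univ MeasurableSet.univ (measurableSet_singleton 1))).2 ?_
      have : ∀ᵐ y ∂μ.restrict c.domain, stayVolume φ c.domain univ y ≠ ∞ :=
        ae_restrict_of_ae hfin
      rw [← map_comap_subtype_coe hU] at this
      filter_upwards [ae_of_ae_map measurable_subtype_coe.aemeasurable this] with y hy
      have h2 : stayVolume φ c.domain (Subtype.val '' (univ : Set c.domain)) y =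
          stayVolume φ c.domain univ y := by
        rw [image_univ, Subtype.range_coe]
        unfold stayVolume
        congr 1
        ext t
        simp only [mem_inter_iff, mem_ofPred_eq, mem_univ, and_true, and_iff_left_iff_imp]
        exact flow_mem_of_mem_stayTimes
      rw [c.plaqueMeasure_proj y MeasurableSet.univ, h2]
      exact ENNReal.inv_mul_cancel (c.stayVolume_univ_ne_zero y.2) hy
    · refine Filter.Eventually.of_forall fun q => ?_
      have hy : c.basePoint q ∈ c.plaque q := mem_range_self _
      have hq := (c.mem_plaque_iff ⟨_, c.plaque_subset_domain q hy⟩ q).1 hy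
      have hm := c.measurableSet_plaque ⟨_, c.plaque_subset_domain q hy⟩
      rw [hq] at hm
      have hpre : c.proj ⁻¹' {q} = Subtype.val ⁻¹' c.plaque q := by
        ext y
        exact (c.mem_plaque_iff y q).symm
      have hB : MeasurableSet (c.proj ⁻¹' {q})ᶜ := by
        rw [hpre]
        exact (measurable_subtype_coe hm).compl
      rw [plaqueMeasure, Measure.smul_apply, comap_subtype_coe_apply hU,
        Measure.restrict_apply (hU.subtype_image hB)]
      have : Subtype.val '' (c.proj ⁻¹' {q})ᶜ ∩ c.plaque q = ∅ := by
        rw [hpre]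
        refine eq_empty_of_forall_notMem ?_
        rintro _ ⟨⟨y, hy, rfl⟩, hy'⟩
        exact hy hy'
      rw [this, measure_empty, smul_zero]
  · intro B hB
    have hB' : MeasurableSet (Subtype.val '' B) := hU.subtype_image hB
    have hL := measurable_stayVolume φ c.isOpen_domain MeasurableSet.univ
    rw [lintegral_map (hmeas B hB) hproj]
    simp_rw [c.plaqueMeasure_proj _ hB]
    rw [lintegral_subtype_comap hU (f := fun y => (stayVolume φ c.domain univ y)⁻¹ *
      stayVolume φ c.domain (Subtype.val '' B) y), comap_subtype_coe_apply hU,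
      setLIntegral_eq_of_support_subset]
    -- With the inverse plaque length as weight, the mass received at almost every point of `B` is
    -- `1`.
    · rw [lintegral_mul_stayVolume φ μ hμ c.isOpen_domain hB' (w := fun y =>
        (stayVolume φ c.domain univ y)⁻¹) hL.inv
        fun y t ht => by rw [c.stayVolume_flow MeasurableSet.univ y ht]]
      rw [← setLIntegral_one]
      refine setLIntegral_congr_fun_ae hB' ?_
      filter_upwards [hfin] with y hy hyB
      obtain ⟨z, -, rfl⟩ := hyB
      exact (ENNReal.inv_mul_cancel (c.stayVolume_univ_ne_zero z.2) hy).symm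
    · intro y hy
      by_contra hyU
      simp [stayVolume_of_notMem φ _ hyU] at hy

theorem isLeafwiseSystem_leafMeasure (φ : Flow ℝ X) (μ : Measure X) [IsFiniteMeasure μ]
    (hμ : ∀ t, MeasurePreserving (φ t) μ μ) : IsLeafwiseSystem φ μ (leafMeasure φ) :=
  ⟨leafMeasure_flow φ, fun c => c.isDisintegration_plaqueMeasure μ hμ⟩

end FoliatedChart

/-! ### Mean ergodic theorem and almost everywhere convergence along a subsequence. -/

section MeanErgodic

variable {X : Type u} [MeasurableSpace X]

/-- The mean ergodic theorem for the indicator of a set, as a convergence in measure. -/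
theorem tendstoInMeasure_birkhoffAverage_indicator {f : X → X} {μ : Measure X}
    [IsProbabilityMeasure μ] (hf : Ergodic f μ) {s : Set X} (hs : MeasurableSet s) :
    TendstoInMeasure μ (fun n => birkhoffAverage ℝ f (s.indicator (1 : X → ℝ)) n) atTop
      fun _ => μ.real s := by
  have hmp := hf.toMeasurePreserving
  let U : Lp ℝ 2 μ →L[ℝ] Lp ℝ 2 μ :=
    (Lp.compMeasurePreservingₗᵢ ℝ f hmp).toContinuousLinearMap
  have hU : ⇑U = Lp.compMeasurePreserving f hmp := rfl
  have hnorm : ‖U‖ ≤ 1 := LinearIsometry.norm_toContinuousLinearMap_le _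
  let g : Lp ℝ 2 μ := indicatorConstLp 2 hs (measure_ne_top μ s) (1 : ℝ)
  have hg : g =ᵐ[μ] s.indicator (1 : X → ℝ) := indicatorConstLp_coeFn
  let e : Lp ℝ 2 μ := indicatorConstLp 2 MeasurableSet.univ (measure_ne_top μ univ) (1 : ℝ)
  have he : e =ᵐ[μ] 1 := by
    have : e =ᵐ[μ] univ.indicator fun _ => (1 : ℝ) := indicatorConstLp_coeFn
    rwa [indicator_univ] at this
  have htend := U.tendsto_birkhoffAverage_orthogonalProjection hnorm g
  set K := U.eqLocus (1 : Lp ℝ 2 μ →L[ℝ] Lp ℝ 2 μ) with hK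
  set P := K.orthogonalProjectionOnto g with hP
  have heK : e ∈ K := by
    change U e = e
    refine Lp.ext ?_
    rw [hU]
    refine (Lp.coeFn_compMeasurePreserving e hmp).trans ?_
    refine (hmp.quasiMeasurePreserving.ae_eq_comp he).trans ?_
    exact he.symm
  have hPfix : U P = P := P.2
  -- The projection is invariant, hence constant by ergodicity; pairing with the invariant function
  -- `1` identifies the constant.
  obtain ⟨r, hr⟩ := hf.ae_eq_const_of_ae_eq_comp_ae (g := (P : Lp ℝ 2 μ))
    (Lp.aestronglyMeasurable _) (by
      refine (Lp.coeFn_compMeasurePreserving (P : Lp ℝ 2 μ) hmp).symm.trans ?_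
      rw [← hU, hPfix])
  have hrs : r = μ.real s := by
    have h1 : inner ℝ e (P : Lp ℝ 2 μ) = inner ℝ e g :=
      K.inner_orthogonalProjectionOnto_eq_of_mem_left ⟨e, heK⟩ g
    rw [L2.inner_indicatorConstLp_one, L2.inner_indicatorConstLp_one, Measure.restrict_univ,
      integral_congr_ae hr, integral_congr_ae hg, integral_indicator_one hs] at h1
    simpa using h1
  refine (tendstoInMeasure_of_tendsto_Lp htend).congr (fun n => ?_) (hrs ▸ hr)
  rw [birkhoffAverage, birkhoffSum]
  refine (Lp.coeFn_smul _ _).trans ?_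
  have hi : ∀ i ∈ Finset.range n, (U^[i] g : Lp ℝ 2 μ) =ᵐ[μ]
      fun x => s.indicator (1 : X → ℝ) (f^[i] x) := by
    intro i _
    rw [hU, Lp.compMeasurePreserving_iterate]
    refine (Lp.coeFn_compMeasurePreserving g (hmp.iterate i)).trans ?_
    exact (hmp.iterate i).quasiMeasurePreserving.ae_eq_comp hg
  have hall : ∀ᵐ x ∂μ, ∀ i ∈ Finset.range n, (U^[i] g : Lp ℝ 2 μ) x =
      s.indicator (1 : X → ℝ) (f^[i] x) := (ae_ball_iff (Finset.countable_toSet _)).2 hi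
  filter_upwards [Lp.coeFn_finsetSum (Finset.range n) fun i => id (U^[i] g), hall] with x h1 h2
  rw [Pi.smul_apply, h1, Finset.sum_apply]
  simp only [id]
  rw [Finset.sum_congr rfl h2]
  rfl

/-- A countable family of sequences that converge in measure has a common subsequence along which
all of them converge almost everywhere. -/
theorem exists_strictMono_forall_tendsto_ae {ι : Type*} [Countable ι] {μ : Measure X}
    {F : ι → ℕ → X → ℝ} {g : ι → X → ℝ} (h : ∀ i, TendstoInMeasure μ (F i) atTop (g i)) :
    ∃ ns : ℕ → ℕ, StrictMono ns ∧
      ∀ᵐ x ∂μ, ∀ i, Tendsto (fun k => F i (ns k) x) atTop (𝓝 (g i x)) := by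
  have := Encodable.ofCountable ι
  have hpos : ∀ k : ℕ, 0 < (1 / 2 : ℝ) ^ k := fun k => by positivity
  -- Stage `k` constrains only the finitely many indices with code at most `k`, so one time serves
  -- them all; Borel–Cantelli then applies to each index.
  have hev : ∀ k, ∀ᶠ n in atTop, ∀ i ∈ {i : ι | Encodable.encode i ≤ k},
      μ {x | (1 / 2 : ℝ) ^ k ≤ dist (F i n x) (g i x)} ≤ (2⁻¹ : ℝ≥0∞) ^ k := by
    intro k
    have hfin : {i : ι | Encodable.encode i ≤ k}.Finite :=
      (finite_Iic k).preimage Encodable.encode_injective.injOn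
    rw [eventually_all_finite hfin]
    intro i _
    have := tendstoInMeasure_iff_dist.1 (h i) _ (hpos k)
    exact this.eventually_le_const (ENNReal.pow_pos (by simp) k)
  obtain ⟨ns, hns, hP⟩ := extraction_forall_of_eventually hev
  refine ⟨ns, hns, ae_all_iff.2 fun i => ?_⟩
  have hsum : ∑' k, μ {x | Encodable.encode i ≤ k ∧
      (1 / 2 : ℝ) ^ k ≤ dist (F i (ns k) x) (g i x)} ≠ ∞ := by
    refine ne_top_of_le_ne_top (b := ∑' k, (2⁻¹ : ℝ≥0∞) ^ k) ?_ (ENNReal.tsum_le_tsum fun k => ?_)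
    · rw [ENNReal.tsum_geometric]
      simp
    · by_cases hk : Encodable.encode i ≤ k
      · exact (measure_mono fun x hx => hx.2).trans (hP k i hk)
      · simp [hk]
  filter_upwards [ae_eventually_notMem hsum] with x hx
  rw [tendsto_iff_dist_tendsto_zero]
  refine squeeze_zero' (Eventually.of_forall fun _ => dist_nonneg) ?_
    (tendsto_pow_atTop_nhds_zero_of_lt_one (r := (1 / 2 : ℝ)) (by norm_num) (by norm_num))
  filter_upwards [hx, eventually_ge_atTop (Encodable.encode i)] with k hk hik
  by_contra hcon
  exact hk ⟨hik, (not_le.1 hcon).le⟩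

end MeanErgodic

/-! ### Visit frequencies. -/

section BirkhoffIndicator

variable {X : Type*}

theorem birkhoffAverage_indicator_mono (f : X → X) {s t : Set X} (h : s ⊆ t) (n : ℕ) (x : X) :
    birkhoffAverage ℝ f (s.indicator (1 : X → ℝ)) n x ≤
      birkhoffAverage ℝ f (t.indicator (1 : X → ℝ)) n x := by
  refine smul_le_smul_of_nonneg_left (Finset.sum_le_sum fun i _ => ?_) (by positivity)
  exact indicator_le_indicator_of_subset h (fun _ => zero_le_one) _

theorem birkhoffAverage_indicator_add_le (f : X → X) {s t : Set X} (h : Disjoint s t) (n : ℕ)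
    (x : X) : birkhoffAverage ℝ f (s.indicator (1 : X → ℝ)) n x +
      birkhoffAverage ℝ f (t.indicator (1 : X → ℝ)) n x ≤ 1 := by
  rw [birkhoffAverage, birkhoffAverage, ← smul_add, birkhoffSum, birkhoffSum,
    ← Finset.sum_add_distrib, smul_eq_mul]
  have : ∑ i ∈ Finset.range n, (s.indicator (1 : X → ℝ) (f^[i] x) +
      t.indicator (1 : X → ℝ) (f^[i] x)) ≤ n := by
    refine (Finset.sum_le_sum (g := fun _ => (1 : ℝ)) fun i _ => ?_).trans (by simp)
    by_cases hi : f^[i] x ∈ s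
    · simp [hi, disjoint_left.1 h hi]
    · simpa [hi] using indicator_le_self' (s := t) (f := (1 : X → ℝ)) (fun _ _ => zero_le_one) _
  exact inv_mul_le_one_of_le₀ this (Nat.cast_nonneg n)

theorem birkhoffAverage_indicator_comp_eq {f h : X → X} (hfh : Function.Commute h f) (s : Set X)
    (n : ℕ) (x : X) : birkhoffAverage ℝ f (s.indicator (1 : X → ℝ)) n (h x) =
      birkhoffAverage ℝ f ((h ⁻¹' s).indicator (1 : X → ℝ)) n x := by
  rw [birkhoffAverage, birkhoffAverage, birkhoffSum, birkhoffSum]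
  congr 1
  refine Finset.sum_congr rfl fun i _ => ?_
  rw [← (hfh.iterate_right i) x]
  rfl

theorem measurable_birkhoffAverage_indicator [MeasurableSpace X] {f : X → X} (hf : Measurable f)
    {s : Set X}
    (hs : MeasurableSet s) (n : ℕ) :
    Measurable (birkhoffAverage ℝ f (s.indicator (1 : X → ℝ)) n) := by
  have h : birkhoffAverage ℝ f (s.indicator (1 : X → ℝ)) n =
      fun x => (n : ℝ)⁻¹ * ∑ i ∈ Finset.range n, s.indicator (1 : X → ℝ) (f^[i] x) := rfl
  rw [h]
  refine measurable_const.mul (Finset.measurable_fun_sum _ fun i _ => ?_)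
  exact (measurable_one.indicator hs).comp (hf.iterate i)

end BirkhoffIndicator

/-! ### Generic points and the uniqueness of their measure. -/

section Generic

variable {X : Type u} [MetricSpace X] [MeasurableSpace X]

/-- The points whose empirical measures along the times `ns k` converge to `μ`. -/
def genericSet (f : X → X) (ns : ℕ → ℕ) (μ : Measure X) : Set X :=
  {x | ∀ O : Set X, IsOpen O → ∀ a < μ.real O,
    ∀ᶠ k in atTop, a < birkhoffAverage ℝ f (O.indicator (1 : X → ℝ)) (ns k) x}

/-- A sequence of open sets whose finite unions approximate the measure of every open set. -/
theorem exists_seq_isOpen_lt_measureReal [TopologicalSpace.SeparableSpace X] :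
    ∃ b : ℕ → Set X, (∀ n, IsOpen (b n)) ∧ ∀ (μ : Measure X) [IsFiniteMeasure μ] (O : Set X),
      IsOpen O → ∀ a < μ.real O, ∃ F : Finset ℕ, (⋃ n ∈ F, b n) ⊆ O ∧ a < μ.real (⋃ n ∈ F, b n) := by
  have : SecondCountableTopology X := UniformSpace.secondCountable_of_separable X
  obtain ⟨B, hBc, -, hB⟩ := TopologicalSpace.exists_countable_basis X
  obtain ⟨b, hb⟩ := (hBc.insert ∅).exists_eq_range (insert_nonempty _ _)
  have hbo : ∀ n, IsOpen (b n) := by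
    intro n
    have : b n ∈ insert ∅ B := hb ▸ mem_range_self n
    rcases this with h | h
    · rw [h]
      exact isOpen_empty
    · exact hB.isOpen h
  refine ⟨b, hbo, fun μ _ O hO a ha => ?_⟩
  classical
  let F : ℕ → Finset ℕ := fun m => (Finset.range m).filter fun n => b n ⊆ O
  have hsub : ∀ m, (⋃ n ∈ F m, b n) ⊆ O := fun m =>
    iUnion₂_subset fun n hn => (Finset.mem_filter.1 hn).2
  have hmono : Monotone fun m => ⋃ n ∈ F m, b n := by
    intro m m' hmm
    refine biUnion_subset_biUnion_left fun n hn => ?_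
    have hn := Finset.mem_filter.1 hn
    exact Finset.mem_filter.2
      ⟨Finset.mem_range.2 ((Finset.mem_range.1 hn.1).trans_le hmm), hn.2⟩
  have hun : ⋃ m, ⋃ n ∈ F m, b n = O := by
    refine Subset.antisymm (iUnion_subset hsub) fun x hx => ?_
    obtain ⟨V, hV, hxV, hVO⟩ := hB.exists_subset_of_mem_open hx hO
    have : V ∈ range b := hb ▸ mem_insert_of_mem _ hV
    obtain ⟨n, rfl⟩ := this
    refine mem_iUnion.2 ⟨n + 1, mem_iUnion₂.2 ⟨n, ?_, hxV⟩⟩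
    exact Finset.mem_filter.2 ⟨Finset.mem_range.2 n.lt_succ_self, hVO⟩
  have ht := tendsto_measure_iUnion_atTop (μ := μ) hmono
  rw [hun] at ht
  have ht' := (ENNReal.tendsto_toReal (measure_ne_top μ O)).comp ht
  obtain ⟨m, hm⟩ := (ht'.eventually_const_lt ha).exists
  exact ⟨F m, hsub m, hm⟩

/-- Reduces genericity to countably many conditions, from which measurability and full measure
follow. -/
theorem genericSet_eq {b : ℕ → Set X} (hbo : ∀ n, IsOpen (b n)) {μ : Measure X}
    (hb : ∀ O : Set X, IsOpen O → ∀ a < μ.real O,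
      ∃ F : Finset ℕ, (⋃ n ∈ F, b n) ⊆ O ∧ a < μ.real (⋃ n ∈ F, b n))
    (f : X → X) (ns : ℕ → ℕ) :
    genericSet f ns μ = {x | ∀ (F : Finset ℕ) (q : ℚ), (q : ℝ) < μ.real (⋃ n ∈ F, b n) →
      ∃ K, ∀ k ≥ K, (q : ℝ) < birkhoffAverage ℝ f
        ((⋃ n ∈ F, b n).indicator (1 : X → ℝ)) (ns k) x} := by
  ext x
  constructor
  · intro hx F q hq
    exact eventually_atTop.1 (hx _ (isOpen_biUnion fun n _ => hbo n) q hq)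
  · intro hx O hO a ha
    obtain ⟨F, hFO, haF⟩ := hb O hO a ha
    obtain ⟨q, haq, hq⟩ := exists_rat_btwn haF
    filter_upwards [eventually_atTop.2 (hx F q hq)] with k hk
    exact haq.trans (hk.trans_le (birkhoffAverage_indicator_mono f hFO _ _))

variable [BorelSpace X]

theorem measurableSet_genericSet [TopologicalSpace.SeparableSpace X] {f : X → X}
    (hf : Measurable f) (ns : ℕ → ℕ) (μ : Measure X) [IsFiniteMeasure μ] :
    MeasurableSet (genericSet f ns μ) := by
  obtain ⟨b, hbo, hb⟩ := exists_seq_isOpen_lt_measureReal (X := X)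
  rw [genericSet_eq hbo (hb μ)]
  simp only [ofPred_forall, ofPred_exists]
  refine MeasurableSet.iInter fun F => MeasurableSet.iInter fun q => MeasurableSet.iInter fun _ =>
    MeasurableSet.iUnion fun K => MeasurableSet.iInter fun k => MeasurableSet.iInter fun _ => ?_
  exact measurableSet_lt measurable_const (measurable_birkhoffAverage_indicator hf
    (isOpen_biUnion fun n _ => hbo n).measurableSet _)

theorem exists_seq_ae_mem_genericSet [TopologicalSpace.SeparableSpace X] {f : X → X}
    {μ : Measure X} [IsProbabilityMeasure μ] (hf : Ergodic f μ) :
    ∃ ns : ℕ → ℕ, ∀ᵐ x ∂μ, x ∈ genericSet f ns μ := by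
  obtain ⟨b, hbo, hb⟩ := exists_seq_isOpen_lt_measureReal (X := X)
  obtain ⟨ns, -, h⟩ := exists_strictMono_forall_tendsto_ae (ι := Finset ℕ) fun F =>
    tendstoInMeasure_birkhoffAverage_indicator hf
      (isOpen_biUnion (s := (F : Set ℕ)) fun n _ => hbo n).measurableSet
  refine ⟨ns, ?_⟩
  filter_upwards [h] with x hx
  rw [genericSet_eq hbo (hb μ)]
  intro F q hq
  exact eventually_atTop.1 ((hx F).eventually_const_lt hq)

theorem map_mem_genericSet {f h : X → X} (hfh : Function.Commute h f) (hh : Continuous h)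
    {ns : ℕ → ℕ} {μ : Measure X} {x : X} (hx : x ∈ genericSet f ns μ) :
    h x ∈ genericSet f ns (μ.map h) := by
  intro O hO a ha
  rw [map_measureReal_apply hh.measurable hO.measurableSet] at ha
  filter_upwards [hx _ (hO.preimage hh) a ha] with k hk
  rwa [birkhoffAverage_indicator_comp_eq hfh]

/-- If the closed `ε`-thickening of `F` had smaller `ν`-measure than the open one has `μ`-measure,
the visit frequencies of the open thickening and of the complement of the closed one would sum to
more than `1`. Letting `ε → 0` gives `μ F ≤ ν F` for closed `F`, and symmetry concludes. -/
theorem eq_of_mem_genericSet {f : X → X} {ns : ℕ → ℕ} {μ ν : Measure X} [IsProbabilityMeasure μ]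
    [IsProbabilityMeasure ν] {x : X} (hμ : x ∈ genericSet f ns μ) (hν : x ∈ genericSet f ns ν) :
    μ = ν := by
  have key : ∀ (μ ν : Measure X) [IsProbabilityMeasure μ] [IsProbabilityMeasure ν],
      x ∈ genericSet f ns μ → x ∈ genericSet f ns ν → ∀ F : Set X, IsClosed F → μ F ≤ ν F := by
    intro μ ν _ _ hμ hν F hF
    have hlim := tendsto_measure_cthickening_of_isClosed (μ := ν)
      ⟨1, one_pos, measure_ne_top _ _⟩ hF
    refine ge_of_tendsto (hlim.mono_left (nhdsWithin_le_nhds (s := Ioi 0))) ?_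
    filter_upwards [self_mem_nhdsWithin] with ε hε
    refine (measure_mono (Metric.self_subset_thickening hε F)).trans ?_
    have hcl : IsClosed (Metric.cthickening ε F) := Metric.isClosed_cthickening
    rw [← ENNReal.toReal_le_toReal (measure_ne_top _ _) (measure_ne_top _ _)]
    change μ.real _ ≤ ν.real _
    by_contra! hlt
    have hco : ν.real (Metric.cthickening ε F)ᶜ = 1 - ν.real (Metric.cthickening ε F) :=
      probReal_compl_eq_one_sub hcl.measurableSet
    obtain ⟨a, ha1, ha2⟩ := exists_between hlt
    obtain ⟨k, hk1, hk2⟩ := ((hμ _ Metric.isOpen_thickening a ha2).and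
      (hν _ hcl.isOpen_compl (1 - a) (by rw [hco]; linarith))).exists
    have := birkhoffAverage_indicator_add_le f (disjoint_compl_right_iff_subset.2
      (Metric.thickening_subset_cthickening ε F)) (ns k) x
    linarith
  refine ext_of_generate_finite _ ?_ isPiSystem_isClosed (fun F hF => ?_) (by simp)
  · rw [← borel_eq_generateFrom_isClosed]
    exact BorelSpace.measurable_eq
  · exact le_antisymm (key μ ν hμ hν F hF) (key ν μ hν hμ F hF)

/-- A measure without atoms has no periodic generic point. -/
theorem iterate_ne_self_of_mem_genericSet {f : X → X} {ns : ℕ → ℕ} {μ : Measure X}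
    [IsProbabilityMeasure μ] [NullSingletonClass μ] {x : X} (hx : x ∈ genericSet f ns μ) {m : ℕ}
    (hm : 0 < m) : f^[m] x ≠ x := by
  intro hper
  have hper' : Function.IsPeriodicPt f m x := hper
  -- The cycle is finite, so its complement is open of full measure, yet `x` never visits it.
  set C : Set X := (fun i => f^[i] x) '' (Finset.range m : Set ℕ) with hC
  have hCf : C.Finite := (Finset.finite_toSet _).image _
  have hmem : ∀ i, f^[i] x ∈ C := fun i =>
    ⟨i % m, by simpa using Nat.mod_lt i hm, hper'.iterate_mod_apply i⟩
  have h0 : μ.real Cᶜ = 1 := by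
    rw [probReal_compl_eq_one_sub hCf.measurableSet, measureReal_def, hCf.measure_zero μ]
    simp
  obtain ⟨k, hk⟩ := (hx _ hCf.isClosed.isOpen_compl 0 (by rw [h0]; exact one_pos)).exists
  rw [birkhoffAverage, birkhoffSum, Finset.sum_eq_zero] at hk
  · simp at hk
  · intro i _
    exact indicator_of_notMem (notMem_compl_iff.2 (hmem i)) _

end Generic

/-! ### Leaf topology and time-one orbits. -/

section Leaf

variable {X : Type u} [TopologicalSpace X]

/-- In the final topology, closedness is tested on times, and a set all of whose subsets are closed
is discrete. -/
theorem discreteInLeaf_of_isClosed (φ : Flow ℝ X) (x : X) {A : Set X}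
    (h : ∀ E ⊆ A, IsClosed {t : ℝ | φ t x ∈ E}) : DiscreteInLeaf φ x A := by
  let _ : TopologicalSpace (φ.orbit x) := leafTopology φ x
  refine (isDiscrete_iff_discreteTopology (s := {y : φ.orbit x | (y : X) ∈ A})).2 ?_
  rw [discreteTopology_iff_forall_isClosed]
  intro s
  have hcl : IsClosed (Subtype.val '' s : Set (φ.orbit x)) := by
    refine isClosed_coinduced.2 ?_
    convert h (Subtype.val '' (Subtype.val '' s : Set (φ.orbit x))) ?_ using 1
    · ext t
      simp only [mem_preimage, mem_ofPred_eq]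
      rw [← Subtype.val_injective.mem_set_image]
    · rintro _ ⟨_, ⟨y, -, rfl⟩, rfl⟩
      exact y.2
  rw [← preimage_image_eq s Subtype.val_injective]
  exact hcl.preimage continuous_subtype_val

theorem iterate_flow_one (φ : Flow ℝ X) (n : ℕ) (x : X) : (φ 1)^[n] x = φ n x := by
  induction n with
  | zero => simp
  | succ n ih => rw [Function.iterate_succ_apply', ih, ← φ.map_add, Nat.cast_succ, add_comm]

theorem flow_commute (φ : Flow ℝ X) (s t : ℝ) : Function.Commute (φ s) (φ t) := fun x => by
  rw [← φ.map_add, ← φ.map_add, add_comm]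

theorem preimage_timeOneOrbit (φ : Flow ℝ X) (x : X) :
    φ 1 ⁻¹' timeOneOrbit φ x = timeOneOrbit φ x := by
  ext y
  constructor
  · rintro ⟨n, hn⟩
    refine ⟨n - 1, ?_⟩
    simp only at hn ⊢
    rw [Int.cast_sub, Int.cast_one, sub_eq_neg_add, φ.map_add, hn, ← φ.map_add, neg_add_cancel,
      φ.map_zero_apply]
  · rintro ⟨n, rfl⟩
    refine ⟨n + 1, ?_⟩
    simp only
    rw [← φ.map_add, Int.cast_add, Int.cast_one, add_comm]

theorem finite_timeOneOrbit (φ : Flow ℝ X) {x : X} {m : ℕ} (hm : 0 < m) (hx : φ m x = x) :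
    (timeOneOrbit φ x).Finite := by
  refine ((finite_Ico (0 : ℤ) m).image fun n : ℤ => φ (n : ℝ) x).subset ?_
  rintro _ ⟨n, rfl⟩
  refine ⟨n % m, ⟨Int.emod_nonneg _ (by omega), Int.emod_lt_of_pos _ (by omega)⟩, ?_⟩
  simp only
  rw [flow_eq_flow_iff]
  have h : ((n % m : ℤ) : ℝ) - n = -((n / m : ℤ) • (m : ℝ)) := by
    have := Int.emod_add_mul_ediv n m
    have h2 : ((n % m : ℤ) : ℝ) + m * (n / m : ℤ) = n := by exact_mod_cast this
    rw [zsmul_eq_mul]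
    linarith
  rw [h]
  exact neg_mem (zsmul_mem (mem_periods.2 hx) _)

end Leaf

/-! ### The group of invariance times and the two alternatives. -/

section Dichotomy

variable {X : Type u} [MetricSpace X] [MeasurableSpace X] [BorelSpace X]

/-- An ergodic measure with an atom lives on a finite orbit of the time-one map. -/
theorem exists_of_measure_singleton_ne_zero (φ : Flow ℝ X) {μ : Measure X} [IsProbabilityMeasure μ]
    (hμ : Ergodic (φ 1) μ) {x : X} (hx : μ {x} ≠ 0) :
    ∃ A : Set X, MeasurableSet A ∧ μ Aᶜ = 0 ∧ (∀ x : X, DiscreteInLeaf φ x A) ∧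
      ∃ k : ℕ, 1 ≤ k ∧ ∀ x ∈ A, IsTimeOneOrbitOfExactly φ k (φ.orbit x ∩ A) := by
  -- Poincaré recurrence for the set `{x}` says that `x` is periodic.
  obtain ⟨y, hy, m, hm, hm'⟩ := hμ.toMeasurePreserving.exists_mem_iterate_mem
    (measurableSet_singleton x).nullMeasurableSet hx
  rw [mem_singleton_iff] at hy hm'
  rw [hy, iterate_flow_one] at hm'
  have hfin := finite_timeOneOrbit φ (Nat.pos_of_ne_zero hm) hm'
  have hmeas := hfin.measurableSet
  refine ⟨timeOneOrbit φ x, hmeas, ?_, fun z => discreteInLeaf_of_isClosed φ z fun E hE =>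
    (hfin.subset hE).isClosed.preimage (continuous_flow_time φ z), 1, le_rfl, fun z hz => ?_⟩
  · refine (hμ.measure_self_or_compl_eq_zero hmeas (preimage_timeOneOrbit φ x)).resolve_left ?_
    have hxC : x ∈ timeOneOrbit φ x := ⟨0, by simp⟩
    exact fun h0 => hx (measure_mono_null (singleton_subset_iff.2 hxC) h0)
  · refine ⟨fun _ => x, fun i j hij => absurd (Subsingleton.elim i j) hij, ?_⟩
    rw [iUnion_const, inter_eq_right]
    obtain ⟨n, rfl⟩ := hz
    rintro _ ⟨j, rfl⟩
    refine φ.mem_orbit_iff.2 ⟨j - n, ?_⟩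
    simp only
    rw [← φ.map_add, sub_add_cancel]

/-- The times `t` for which `φ t` preserves `μ`. -/
noncomputable def invarianceTimes (φ : Flow ℝ X) (μ : Measure X) : AddSubgroup ℝ where
  carrier := {t | μ.map (φ t) = μ}
  zero_mem' := by simp
  add_mem' {s t} hs ht := by
    simp only [mem_ofPred_eq] at *
    have : φ (s + t) = φ s ∘ φ t := funext (φ.map_add s t)
    rw [this, ← Measure.map_map (φ.continuous_toFun s).measurable (φ.continuous_toFun t).measurable,
      ht, hs]
  neg_mem' {t} ht := by
    simp only [mem_ofPred_eq] at *
    conv_lhs => rw [← ht]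
    rw [Measure.map_map (φ.continuous_toFun _).measurable (φ.continuous_toFun t).measurable]
    have : φ (-t) ∘ φ t = id := funext fun x => by
      rw [Function.comp_apply, ← φ.map_add, neg_add_cancel, φ.map_zero_apply, id]
    rw [this, Measure.map_id]

theorem mem_invarianceTimes {φ : Flow ℝ X} {μ : Measure X} {t : ℝ} :
    t ∈ invarianceTimes φ μ ↔ μ.map (φ t) = μ := Iff.rfl

/-- Invariance is tested on bounded continuous `g`, and `t ↦ ∫ g (φ t x) dμ` is continuous by
dominated convergence. -/
theorem isClosed_invarianceTimes (φ : Flow ℝ X) (μ : Measure X) [IsFiniteMeasure μ] :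
    IsClosed (invarianceTimes φ μ : Set ℝ) := by
  have h : (invarianceTimes φ μ : Set ℝ) =
      ⋂ g : BoundedContinuousFunction X ℝ, {t | ∫ x, g (φ t x) ∂μ = ∫ x, g x ∂μ} := by
    ext t
    have hm : Measurable (φ t) := (φ.continuous_toFun t).measurable
    have hmap : ∀ g : BoundedContinuousFunction X ℝ,
        ∫ x, g x ∂(μ.map (φ t)) = ∫ x, g (φ t x) ∂μ := fun g =>
      integral_map hm.aemeasurable g.continuous.measurable.aestronglyMeasurable
    simp only [SetLike.mem_coe, mem_invarianceTimes, mem_iInter, mem_ofPred_eq, ← hmap]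
    refine ⟨fun h g => by rw [h], fun h => ?_⟩
    have : IsFiniteMeasure (μ.map (φ t)) := inferInstance
    exact ext_of_forall_integral_eq_of_IsFiniteMeasure h
  rw [h]
  refine isClosed_iInter fun g => isClosed_eq ?_ continuous_const
  refine continuous_of_dominated (bound := fun _ => ‖g‖) (fun t => ?_) (fun t => ?_)
    (integrable_const _) (Eventually.of_forall fun x => ?_)
  · exact (g.continuous.comp (φ.continuous_toFun t)).measurable.aestronglyMeasurable
  · exact Eventually.of_forall fun x => g.norm_coe_le_norm _
  · exact g.continuous.comp (continuous_flow_time φ x)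

/-- `φ t x` is always generic for the image of `μ` under `φ t`, so uniqueness decides whether it is
generic for `μ`. -/
theorem flow_mem_genericSet_iff (φ : Flow ℝ X) {μ : Measure X} [IsProbabilityMeasure μ]
    {ns : ℕ → ℕ} {x : X} (hx : x ∈ genericSet (φ 1) ns μ) (t : ℝ) :
    φ t x ∈ genericSet (φ 1) ns μ ↔ t ∈ invarianceTimes φ μ := by
  have ht := map_mem_genericSet (flow_commute φ t 1) (φ.continuous_toFun t) hx
  have : IsProbabilityMeasure (μ.map (φ t)) :=
    Measure.isProbabilityMeasure_map (φ.continuous_toFun t).measurable.aemeasurable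
  refine ⟨fun h => mem_invarianceTimes.2 (eq_of_mem_genericSet ht h), fun h => ?_⟩
  rwa [mem_invarianceTimes.1 h] at ht

theorem flow_ne_self_of_mem_genericSet (φ : Flow ℝ X) {μ : Measure X} [IsProbabilityMeasure μ]
    [NullSingletonClass μ] {ns : ℕ → ℕ} {x : X} (hx : x ∈ genericSet (φ 1) ns μ) {j : ℤ}
    (hj : j ≠ 0) : φ j x ≠ x := by
  intro h
  refine iterate_ne_self_of_mem_genericSet hx (Int.natAbs_pos.2 hj) ?_
  rw [iterate_flow_one, ← mem_periods]
  have hj' : (j : ℝ) ∈ periods φ x := h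
  rw [Nat.cast_natAbs, Int.cast_abs]
  rcases abs_choice (j : ℝ) with h1 | h1 <;> rw [h1]
  · exact hj'
  · exact neg_mem hj'

/-- If the atomless ergodic measure `μ` is preserved only by the multiples of `a = 1 / n`, then the
generic points of an orbit form `n` orbits of the time-one map. -/
theorem exists_of_invarianceTimes_eq_zmultiples [TopologicalSpace.SeparableSpace X] (φ : Flow ℝ X)
    {μ : Measure X} [IsProbabilityMeasure μ] [NullSingletonClass μ] {ns : ℕ → ℕ}
    (hns : ∀ᵐ x ∂μ, x ∈ genericSet (φ 1) ns μ) {a : ℝ} (ha : 0 < a) {n : ℕ} (hn : 0 < n)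
    (hna : n * a = 1) (hH : invarianceTimes φ μ = AddSubgroup.zmultiples a) :
    ∃ A : Set X, MeasurableSet A ∧ μ Aᶜ = 0 ∧ (∀ x : X, DiscreteInLeaf φ x A) ∧
      ∃ k : ℕ, 1 ≤ k ∧ ∀ x ∈ A, IsTimeOneOrbitOfExactly φ k (φ.orbit x ∩ A) := by
  have hmem : ∀ {x : X}, x ∈ genericSet (φ 1) ns μ → ∀ t : ℝ,
      φ t x ∈ genericSet (φ 1) ns μ ↔ ∃ j : ℤ, j * a = t := by
    intro x hx t
    rw [flow_mem_genericSet_iff φ hx, hH, AddSubgroup.mem_zmultiples_iff]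
    simp only [zsmul_eq_mul]
  have hfree : ∀ {x : X}, x ∈ genericSet (φ 1) ns μ → ∀ j : ℤ, φ (j * a) x = x → j = 0 := by
    intro x hx j hj
    by_contra hj0
    refine flow_ne_self_of_mem_genericSet φ hx hj0 ?_
    -- As `n * a = 1`, a period `j * a` yields the integer period `j`, which a generic point of an
    -- atomless measure excludes.
    have : (n : ℕ) • (j * a : ℝ) ∈ periods φ x := nsmul_mem (mem_periods.2 hj) n
    rw [nsmul_eq_mul, mul_left_comm, hna, mul_one] at this
    exact this
  refine ⟨genericSet (φ 1) ns μ,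
    measurableSet_genericSet (φ.continuous_toFun 1).measurable ns μ, hns, fun y => ?_, n, hn,
    fun x hx => ⟨fun i => φ (i * a) x, ?_, ?_⟩⟩
  · refine discreteInLeaf_of_isClosed φ y fun E hE => ?_
    -- Taking the generic point `φ s y` as base point, two distinct times in the set differ by a
    -- nonzero multiple of `a`; `y` itself may be arbitrary.
    refine Metric.isClosed_of_pairwise_le_dist ha fun t ht s hs hts => ?_
    have h1 : φ (t - s) (φ s y) ∈ genericSet (φ 1) ns μ := by
      rw [← φ.map_add, sub_add_cancel]
      exact hE ht
    obtain ⟨j, hj⟩ := (hmem (hE hs) _).1 h1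
    have hj0 : j ≠ 0 := by
      rintro rfl
      simp only [Int.cast_zero, zero_mul] at hj
      exact hts (by linarith)
    change a ≤ dist t s
    rw [Real.dist_eq, ← hj, abs_mul, abs_of_pos ha]
    have : (1 : ℝ) ≤ |(j : ℝ)| := by exact_mod_cast Int.one_le_abs hj0
    nlinarith
  · intro i i' hii
    refine disjoint_left.2 ?_
    rintro _ ⟨m, rfl⟩ ⟨m', hm⟩
    simp only at hm
    rw [← φ.map_add, ← φ.map_add, flow_eq_flow_iff] at hm
    have he : (m' + (i' : ℕ) * a - (m + (i : ℕ) * a) : ℝ) =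
        (((m' - m) * n + ((i' : ℕ) - (i : ℕ)) : ℤ) : ℝ) * a := by
      push_cast
      linear_combination (m - m' : ℝ) * hna
    rw [he] at hm
    have h0 := hfree hx _ hm
    have hi := i.2
    have hi' := i'.2
    have hdiv : (n : ℤ) ∣ (i' : ℕ) - (i : ℕ) := ⟨-(m' - m), by linear_combination h0⟩
    have := Int.eq_zero_of_abs_lt_dvd hdiv (by rw [abs_lt]; constructor <;> omega)
    exact hii (Fin.ext (by omega))
  · ext z
    constructor
    · rintro ⟨hz, hzG⟩
      obtain ⟨t, rfl⟩ := φ.mem_orbit_iff.1 hz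
      obtain ⟨j, rfl⟩ := (hmem hx t).1 hzG
      have hlt := Int.emod_lt_of_pos j (by omega : (0 : ℤ) < n)
      have hnn := Int.emod_nonneg j (by omega : (n : ℤ) ≠ 0)
      -- The remainder of `j` modulo `n` selects the time-one orbit, the quotient the position on
      -- it.
      refine mem_iUnion.2 ⟨⟨(j % n).toNat, by omega⟩, j / n, ?_⟩
      simp only
      rw [← φ.map_add]
      congr 1
      have h1 : (((j % n).toNat : ℕ) : ℝ) = ((j % n : ℤ) : ℝ) := by
        exact_mod_cast congrArg (Int.cast (R := ℝ)) (Int.toNat_of_nonneg hnn)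
      have h2 : ((j % n : ℤ) : ℝ) + n * (j / n : ℤ) = j := by
        exact_mod_cast Int.emod_add_mul_ediv j n
      rw [h1]
      linear_combination a * h2 - ((j / n : ℤ) : ℝ) * hna
    · intro hz
      obtain ⟨i, m, rfl⟩ := mem_iUnion.1 hz
      simp only
      rw [← φ.map_add]
      refine ⟨φ.mem_orbit x _, (hmem hx _).2 ⟨m * n + (i : ℕ), ?_⟩⟩
      push_cast
      linear_combination (m : ℝ) * hna

end Dichotomy

end OrbitFlow

theorem theoremA {X : Type u} [MetricSpace X] [TopologicalSpace.SeparableSpace X]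
    [MeasurableSpace X] [BorelSpace X] (φ : Flow ℝ X)
    (μ : Measure X) [IsProbabilityMeasure μ] (hμ : Ergodic (φ 1) μ) :
    (∃ A : Set X, MeasurableSet A ∧ μ Aᶜ = 0 ∧
      (∀ x : X, OrbitFlow.DiscreteInLeaf φ x A) ∧
      ∃ k : ℕ, 1 ≤ k ∧ ∀ x ∈ A, OrbitFlow.IsTimeOneOrbitOfExactly φ k (φ.orbit x ∩ A)) ∨
    ((∃ m : X → Measure X, OrbitFlow.IsLeafwiseSystem φ μ m ∧
        ∀ᵐ x ∂μ, m x ≠ 0 ∧ m x (φ.orbit x)ᶜ = 0 ∧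
          MeasurePreserving (φ 1) (m x) (m x) ∧
          ∀ t : ℝ, 0 ≤ t → Set.InjOn (fun τ : ℝ => φ τ x) (Set.Icc 0 t) →
            m x (OrbitFlow.segment φ x t) = ENNReal.ofReal (t / 2)) ∧
      ∀ t : ℝ, MeasurePreserving (φ t) μ μ) := by
  -- Atoms are set apart because generic points are known to be aperiodic for `φ 1` only when `μ`
  -- has none.
  by_cases hatom : ∃ x, μ {x} ≠ 0
  · obtain ⟨x, hx⟩ := hatom
    exact Or.inl (OrbitFlow.exists_of_measure_singleton_ne_zero φ hμ hx)
  push Not at hatom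
  have : NullSingletonClass μ := ⟨hatom⟩
  obtain ⟨ns, hns⟩ := OrbitFlow.exists_seq_ae_mem_genericSet hμ
  by_cases htop : OrbitFlow.invarianceTimes φ μ = ⊤
  · right
    have hinv : ∀ t : ℝ, MeasurePreserving (φ t) μ μ := fun t =>
      ⟨(φ.continuous_toFun t).measurable,
        OrbitFlow.mem_invarianceTimes.1 (htop ▸ AddSubgroup.mem_top t)⟩
    refine ⟨⟨OrbitFlow.leafMeasure φ,
      OrbitFlow.FoliatedChart.isLeafwiseSystem_leafMeasure φ μ hinv, ?_⟩, hinv⟩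
    filter_upwards [hns] with x hx
    have hper : OrbitFlow.periods φ x ≠ ⊤ := by
      intro h
      refine OrbitFlow.flow_ne_self_of_mem_genericSet φ hx one_ne_zero ?_
      rw [← OrbitFlow.mem_periods, h]
      exact AddSubgroup.mem_top _
    exact ⟨OrbitFlow.leafMeasure_ne_zero φ x hper, OrbitFlow.leafMeasure_compl_orbit φ x,
      OrbitFlow.measurePreserving_leafMeasure φ 1 x,
      fun t _ hinj => OrbitFlow.leafMeasure_segment φ x hper hinj⟩
  · left
    obtain ⟨a, ha0, hH⟩ := OrbitFlow.exists_eq_zmultiples_of_ne_top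
      (OrbitFlow.isClosed_invarianceTimes φ μ) htop
    have h1 : (1 : ℝ) ∈ OrbitFlow.invarianceTimes φ μ := hμ.toMeasurePreserving.map_eq
    rw [hH, AddSubgroup.mem_zmultiples_iff] at h1
    obtain ⟨n, hn⟩ := h1
    rw [zsmul_eq_mul] at hn
    have ha : 0 < a := ha0.lt_of_ne (by rintro rfl; simp at hn)
    have hn0 : 0 < n := by
      by_contra! hle
      have : (n : ℝ) ≤ 0 := by exact_mod_cast hle
      nlinarith
    lift n to ℕ using hn0.le
    exact OrbitFlow.exists_of_invarianceTimes_eq_zmultiples φ hns ha (by exact_mod_cast hn0)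
      (by exact_mod_cast hn) hH
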